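/- Let $N\in\mathbb{N}$, $1<p<N$, $\Lambda\in\mathbb{R}$, and put $p^*:=\frac{Np}{N-p}$, $p_*:=\frac{(N-1)p}{N-p}$. Let $\mathcal{D}^{1,p}_0(\mathbb{R}^N)$ be the closure of $C_c^\infty(\mathbb{R}^N)$ with respect to the norm $\|\nabla\cdot\|_{L^p(\mathbb{R}^N)}$, regarded as a space of functions in $L^{p^*}(\mathbb{R}^N)$ with weak gradient in $L^p(\mathbb{R}^N)$. Let $f\in L^1(\mathbb{R}^N)\cap L^q(\mathbb{R}^N)$ for some $q\in\left(\frac Np,\infty\right]$, with $f\ge 0$ a.e. Let $u\in\mathcal{D}^{1,p}_0(\mathbb{R}^N)$ be a weak solution of $$0\le -\Delta_p u\le f(x)+\Lambda u^{p^*-1},\qquad u>0\qquad\text{in }\mathbb{R}^N,$$ that is, $u>0$ a.e. and $$0\le\int_{\mathbb{R}^N}|\nabla u|^{p-2}\nabla u\cdot\nabla\phi\,dx\le\int_{\mathbb{R}^N}f\phi\,dx+\Lambda\int_{\mathbb{R}^N}u^{p^*-1}\phi\,dx$$ for all $\phi\in\mathcal{D}^{1,p}_0(\mathbb{R}^N)$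 with $\phi\ge 0$ a.e. Then $u$ belongs to the weak Lebesgue space $L^{p_*-1,\infty}(\mathbb{R}^N)$, that is, $u$ is measurable and $$\sup_{h>0}\left(h\,\bigl|\{|u|>h\}\bigr|^{1/(p_*-1)}\right)<\infty .$$ In particular, $u\in L^r(\mathbb{R}^N)$ for all $r\in(p_*-1,\infty]$. -/

import Mathlib

open MeasureTheory Filter Topology
open scoped ENNReal ContDiff

noncomputable section

namespace PLaplace

/-- The critical Sobolev exponent `p^* = N p / (N - p)`. -/
def upperStar (N : ℕ) (p : ℝ) : ℝ := N * p / (N - p)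

/-- The exponent `p_* = (N - 1) p / (N - p)`. -/
def lowerStar (N : ℕ) (p : ℝ) : ℝ := (N - 1) * p / (N - p)

/-- `φ ∈ C_c^∞(ℝ^N)`. -/
def IsTestFunction {N : ℕ} (φ : EuclideanSpace ℝ (Fin N) → ℝ) : Prop :=
  ContDiff ℝ ∞ φ ∧ HasCompactSupport φ

/-- `G` is the weak (distributional) gradient of `u` on `ℝ^N`. -/
def HasWeakGradient {N : ℕ} (u : EuclideanSpace ℝ (Fin N) → ℝ)
    (G : EuclideanSpace ℝ (Fin N) → EuclideanSpace ℝ (Fin N)) : Prop :=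
  LocallyIntegrable u ∧ LocallyIntegrable G ∧
    ∀ φ : EuclideanSpace ℝ (Fin N) → ℝ, IsTestFunction φ → ∀ v : EuclideanSpace ℝ (Fin N),
      (∫ x, u x * fderiv ℝ φ x v) = -(∫ x, inner ℝ (G x) v * φ x)

/-- `u ∈ D_0^{1,p}(ℝ^N)` with weak gradient `∇u = G`. The space `D_0^{1,p}` is the closure of
`C_c^∞` with respect to `‖∇ ·‖_p`; since `‖·‖_{p^*} ≤ c ‖∇ ·‖_p` on `C_c^∞`, a sequence of test
functions that is Cauchy in this norm also converges in `L^{p^*}`, and its limit there is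
the function `u` that represents the element of the closure. -/
def IsBeppoLevi {N : ℕ} (p : ℝ) (u : EuclideanSpace ℝ (Fin N) → ℝ)
    (G : EuclideanSpace ℝ (Fin N) → EuclideanSpace ℝ (Fin N)) : Prop :=
  MemLp u (ENNReal.ofReal (upperStar N p)) ∧ MemLp G (ENNReal.ofReal p) ∧ HasWeakGradient u G ∧
    ∃ φ : ℕ → EuclideanSpace ℝ (Fin N) → ℝ, (∀ n, IsTestFunction (φ n)) ∧
      Tendsto (fun n => eLpNorm (fun x => φ n x - u x) (ENNReal.ofReal (upperStar N p)) volume)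
        atTop (𝓝 0) ∧
      Tendsto (fun n => eLpNorm (fun x => gradient (φ n) x - G x) (ENNReal.ofReal p) volume)
        atTop (𝓝 0)

/-- `u ∈ D_0^{1,p}(ℝ^N)` is a weak solution of
`0 ≤ -Δ_p u ≤ f + Λ u^{p^* - 1}`, `u > 0` in `ℝ^N`: for every nonnegative `φ ∈ D_0^{1,p}(ℝ^N)`,
`0 ≤ ∫ |∇u|^{p-2} ∇u · ∇φ ≤ ∫ f φ + Λ ∫ u^{p^* - 1} φ`.
Here `G = ∇u` and `H = ∇φ` (unique up to null sets). -/
def IsSolution {N : ℕ} (p Λ : ℝ) (f u : EuclideanSpace ℝ (Fin N) → ℝ) : Prop :=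
  (∀ᵐ x, 0 < u x) ∧
  ∃ G : EuclideanSpace ℝ (Fin N) → EuclideanSpace ℝ (Fin N), IsBeppoLevi p u G ∧
    ∀ (φ : EuclideanSpace ℝ (Fin N) → ℝ)
      (H : EuclideanSpace ℝ (Fin N) → EuclideanSpace ℝ (Fin N)),
      IsBeppoLevi p φ H → (∀ᵐ x, 0 ≤ φ x) →
        0 ≤ (∫ x, ‖G x‖ ^ (p - 2) * inner ℝ (G x) (H x)) ∧
        (∫ x, ‖G x‖ ^ (p - 2) * inner ℝ (G x) (H x)) ≤
          (∫ x, f x * φ x) + Λ * (∫ x, u x ^ (upperStar N p - 1) * φ x)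

/-- The quasi-norm `‖u‖_{s,∞} = sup_{h > 0} h |{|u| > h}|^{1/s}`. -/
def weakLpQuasiNorm {N : ℕ} (s : ℝ) (u : EuclideanSpace ℝ (Fin N) → ℝ) : ℝ≥0∞ :=
  ⨆ (h : ℝ) (_ : 0 < h), ENNReal.ofReal h * volume {x | h < |u x|} ^ (1 / s)

/-- `u ∈ L^{s,∞}(ℝ^N)`, for `s ∈ (0,∞)`. -/
def MemWeakLp {N : ℕ} (s : ℝ) (u : EuclideanSpace ℝ (Fin N) → ℝ) : Prop :=
  AEStronglyMeasurable u volume ∧ weakLpQuasiNorm s u < ⊤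

end PLaplace

end

/-! Write `P` for `p^*` and `θ = P / p = N / (N - p) > 1`, so that `p_* - 1 = P - θ`. Everything
follows from testing with truncations of `u` and applying the Sobolev inequality.

Weak bound. Testing with `min(u, h)` bounds `A(h)^(1/θ)`, where `A(h) = ∫ min(u,h)^P`, by a constant
times `h ‖f‖₁ + |Λ| (A(h) + h M(h))`, where `M(h) = ∫_{u>h} u^(P-1)`. Since `A(h) → 0` as `h → 0`
and `θ > 1`, the term `A(h)` is absorbed, which leaves `h^P |{u>h}| ≤ A(h) ≤ (K h (1 + M(h)))^θ` for
small `h`. If `M` is bounded, this is the claim. Splitting off the layer `h < u ≤ 2h` gives `M(h) ≤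
M(2h) + D (h (1 + M(h)))^(θ-1) (1 + M(h))`, and `h M(h) → 0` by dominated convergence; along `h =
2^(-k)` this a priori smallness improves itself to geometric decay, so the increments are summable
and `M` is bounded (`exists_bound_of_le_add_rpow_mul`, `exists_weak_bound_of_energy`).

Boundedness. Testing with `(u - k)₊` and absorbing the critical term for large `k` reduces the
problem to a right-hand side in `L^r` with `r > N/p`, where De Giorgi iteration over levels
increasing from `K` to `2K` applies (`exists_ae_bound_of_energy`). The layer-cake formula combines
the two bounds into `u ∈ L^r` for finite `r > p_* - 1`. -/

namespace PLaplace

/-! ### Convergence in Lebesgue spaces -/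

section Lp

variable {α E : Type*} [MeasurableSpace α] {μ : Measure α} [NormedAddCommGroup E]

/-- Dominated convergence in `L^p`. -/
lemma tendsto_eLpNorm_zero_of_dominated {p : ℝ≥0∞} (hp0 : p ≠ 0) (hp : p ≠ ⊤)
    {F : ℕ → α → E} {g : α → ℝ} (hF : ∀ n, AEStronglyMeasurable (F n) μ) (hg : MemLp g p μ)
    (hb : ∀ n, ∀ᵐ x ∂μ, ‖F n x‖ ≤ g x)
    (hlim : ∀ᵐ x ∂μ, Tendsto (fun n => F n x) atTop (𝓝 0)) :
    Tendsto (fun n => eLpNorm (F n) p μ) atTop (𝓝 0) := by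
  have hpt : 0 < p.toReal := ENNReal.toReal_pos hp0 hp
  have key : Tendsto (fun n => ∫⁻ x, ‖F n x‖ₑ ^ p.toReal ∂μ) atTop (𝓝 (∫⁻ _, 0 ∂μ)) := by
    refine tendsto_lintegral_of_dominated_convergence' (fun x => ‖g x‖ₑ ^ p.toReal)
      (fun n => (hF n).enorm.pow_const _) (fun n => ?_)
      ((eLpNorm_lt_top_iff_lintegral_rpow_enorm_lt_top hp0 hp).1 hg.2).ne ?_
    · filter_upwards [hb n] with x hx
      refine ENNReal.rpow_le_rpow ?_ hpt.le
      rw [enorm_le_iff_norm_le]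
      exact hx.trans (Real.le_norm_self _)
    · filter_upwards [hlim] with x hx
      have h1 : Tendsto (fun n => ‖F n x‖ₑ) atTop (𝓝 0) := by simpa using hx.enorm
      simpa [ENNReal.zero_rpow_of_pos hpt, Function.comp_def] using
        ((ENNReal.continuous_rpow_const (y := p.toReal)).tendsto 0).comp h1
  simp only [eLpNorm_eq_lintegral_rpow_enorm_toReal hp0 hp]
  rw [lintegral_zero] at key
  have := (ENNReal.continuous_rpow_const (y := 1 / p.toReal)).tendsto 0 |>.comp key
  rwa [ENNReal.zero_rpow_of_pos (by positivity)] at this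

lemma tendsto_integral_mul_of_tendsto_eLpNorm {p : ℝ≥0∞} (hp : 1 ≤ p)
    {F : ℕ → α → ℝ} {f g : α → ℝ} (hF : ∀ n, MemLp (F n) p μ) (hf : MemLp f p μ)
    (hg : MemLp g p.conjExponent μ)
    (hlim : Tendsto (fun n => eLpNorm (fun x => F n x - f x) p μ) atTop (𝓝 0)) :
    Tendsto (fun n => ∫ x, F n x * g x ∂μ) atTop (𝓝 (∫ x, f x * g x ∂μ)) := by
  have : p.HolderConjugate p.conjExponent := ENNReal.HolderConjugate.conjExponent hp
  refine tendsto_integral_of_L1' _ (hf.integrable_mul hg).1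
    (Eventually.of_forall fun n => (hF n).integrable_mul hg) ?_
  have h1 : Tendsto (fun n => eLpNorm (fun x => F n x - f x) p μ * eLpNorm g p.conjExponent μ)
      atTop (𝓝 0) := by
    simpa using ENNReal.Tendsto.mul_const hlim (Or.inr hg.2.ne)
  refine tendsto_of_tendsto_of_tendsto_of_le_of_le tendsto_const_nhds h1
    (fun _ => zero_le) fun n => ?_
  have h2 := eLpNorm_smul_le_mul_eLpNorm (p := p) (q := p.conjExponent) (r := 1) hg.1
    ((hF n).sub hf).1
  refine le_trans (le_of_eq ?_) h2
  congr 1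
  ext x
  simp [sub_mul]

end Lp

/-! ### The space `D_0^{1,p}`: weak gradients, Sobolev inequality, chain rule -/

section

variable {N : ℕ}

lemma IsTestFunction.continuous_gradient {φ : EuclideanSpace ℝ (Fin N) → ℝ}
    (hφ : IsTestFunction φ) : Continuous (gradient φ) :=
  (LinearIsometryEquiv.continuous _).comp (hφ.1.continuous_fderiv (by simp))

lemma IsTestFunction.hasCompactSupport_gradient {φ : EuclideanSpace ℝ (Fin N) → ℝ}
    (hφ : IsTestFunction φ) : HasCompactSupport (gradient φ) :=
  (hφ.2.fderiv (𝕜 := ℝ)).comp_left (g := (InnerProductSpace.toDual ℝ _).symm) (map_zero _)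

lemma IsTestFunction.memLp {φ : EuclideanSpace ℝ (Fin N) → ℝ} (hφ : IsTestFunction φ)
    (s : ℝ≥0∞) : MemLp φ s := hφ.1.continuous.memLp_of_hasCompactSupport hφ.2

lemma IsTestFunction.memLp_gradient {φ : EuclideanSpace ℝ (Fin N) → ℝ} (hφ : IsTestFunction φ)
    (s : ℝ≥0∞) : MemLp (gradient φ) s :=
  hφ.continuous_gradient.memLp_of_hasCompactSupport hφ.hasCompactSupport_gradient

lemma inner_gradient (φ : EuclideanSpace ℝ (Fin N) → ℝ) (x v : EuclideanSpace ℝ (Fin N)) :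
    inner ℝ (gradient φ x) v = fderiv ℝ φ x v := by
  simp [gradient]

lemma eLpNorm_gradient (φ : EuclideanSpace ℝ (Fin N) → ℝ) (s : ℝ≥0∞) :
    eLpNorm (gradient φ) s = eLpNorm (fderiv ℝ φ) s :=
  eLpNorm_congr_norm_ae (Eventually.of_forall fun x => by simp [gradient])

lemma gradient_comp {φ : EuclideanSpace ℝ (Fin N) → ℝ} {ψ : ℝ → ℝ}
    (hφ : Differentiable ℝ φ) (hψ : Differentiable ℝ ψ) (x : EuclideanSpace ℝ (Fin N)) :
    gradient (ψ ∘ φ) x = deriv ψ (φ x) • gradient φ x := by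
  unfold gradient
  rw [((hψ (φ x)).hasDerivAt.comp_hasFDerivAt x (hφ x).hasFDerivAt).fderiv]
  simp

lemma one_lt_upperStar {p : ℝ} (hp : 1 < p) (hpN : p < N) : 1 < upperStar N p := by
  have : 0 < (N : ℝ) - p := by linarith
  rw [upperStar, lt_div_iff₀ this]
  nlinarith

/-- Integration by parts holds classically for each `φ n`, and both sides pass to the limit because
a test function and its derivatives lie in every conjugate Lebesgue space. -/
lemma hasWeakGradient_of_tendsto {s p : ℝ≥0∞} (hs : 1 ≤ s) (hp : 1 ≤ p)
    {u : EuclideanSpace ℝ (Fin N) → ℝ} {G : EuclideanSpace ℝ (Fin N) → EuclideanSpace ℝ (Fin N)}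
    (hu : MemLp u s) (hG : MemLp G p) {φ : ℕ → EuclideanSpace ℝ (Fin N) → ℝ}
    (hφ : ∀ n, IsTestFunction (φ n))
    (h1 : Tendsto (fun n => eLpNorm (fun x => φ n x - u x) s volume) atTop (𝓝 0))
    (h2 : Tendsto (fun n => eLpNorm (fun x => gradient (φ n) x - G x) p volume) atTop (𝓝 0)) :
    HasWeakGradient u G := by
  refine ⟨hu.locallyIntegrable hs, hG.locallyIntegrable hp, fun χ hχ v => ?_⟩
  have hχ' : Continuous (fun x => fderiv ℝ χ x v) :=
    (hχ.1.continuous_fderiv (by simp)).clm_apply continuous_const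
  have hχc : HasCompactSupport (fun x => fderiv ℝ χ x v) := hχ.2.fderiv_apply (𝕜 := ℝ) v
  have t1 := tendsto_integral_mul_of_tendsto_eLpNorm hs (fun n => (hφ n).memLp s) hu
    (hχ'.memLp_of_hasCompactSupport hχc) h1
  have hin : ∀ {K : EuclideanSpace ℝ (Fin N) → EuclideanSpace ℝ (Fin N)}, MemLp K p →
      MemLp (fun x => inner ℝ (K x) v) p := fun hK => hK.inner_const v
  have t2 := tendsto_integral_mul_of_tendsto_eLpNorm hp
    (F := fun n x => inner ℝ (gradient (φ n) x) v) (f := fun x => inner ℝ (G x) v) (g := χ)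
    (μ := volume)
    (fun n => hin ((hφ n).memLp_gradient p)) (hin hG) (hχ.memLp _) (by
      have h3 : Tendsto (fun n => ENNReal.ofReal ‖v‖ *
          eLpNorm (fun x => gradient (φ n) x - G x) p volume) atTop (𝓝 0) := by
        have := ENNReal.Tendsto.const_mul (a := ENNReal.ofReal ‖v‖) h2
          (Or.inr ENNReal.ofReal_ne_top)
        rwa [mul_zero] at this
      refine tendsto_of_tendsto_of_tendsto_of_le_of_le tendsto_const_nhds h3
        (fun _ => zero_le) fun n => ?_
      refine eLpNorm_le_mul_eLpNorm_of_ae_le_mul (Eventually.of_forall fun x => ?_) p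
      rw [← inner_sub_left, mul_comm]
      exact norm_inner_le_norm _ _)
  refine tendsto_nhds_unique t1 ?_
  refine Tendsto.congr (fun n => ?_) t2.neg
  simp only [inner_gradient]
  have hc := (hφ n).1.continuous
  have hc' : Continuous (fun x => fderiv ℝ (φ n) x v) :=
    ((hφ n).1.continuous_fderiv (by simp)).clm_apply continuous_const
  refine (integral_mul_fderiv_eq_neg_fderiv_mul_of_integrable ?_ ?_ ?_ ?_ ?_).symm
  · exact (hc'.mul hχ.1.continuous).integrable_of_hasCompactSupport hχ.2.mul_left
  · exact (hc.mul hχ').integrable_of_hasCompactSupport hχc.mul_left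
  · exact (hc.mul hχ.1.continuous).integrable_of_hasCompactSupport hχ.2.mul_left
  · exact fun x _ => (hφ n).1.differentiable (by simp) x
  · exact fun x _ => hχ.1.differentiable (by simp) x

/-- The Sobolev inequality on `D_0^{1,p}`. -/
lemma IsBeppoLevi.exists_sobolev {p : ℝ} (hp : 1 < p) (hpN : p < N) :
    ∃ C : NNReal, ∀ (u : EuclideanSpace ℝ (Fin N) → ℝ)
      (G : EuclideanSpace ℝ (Fin N) → EuclideanSpace ℝ (Fin N)), IsBeppoLevi p u G →
      eLpNorm u (ENNReal.ofReal (upperStar N p)) ≤ C * eLpNorm G (ENNReal.ofReal p) := by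
  have hps := one_lt_upperStar hp hpN
  have hN : 0 < (N : ℝ) := by linarith
  refine ⟨SNormLESNormFDerivOfEqConst ℝ
    (volume : Measure (EuclideanSpace ℝ (Fin N))) p.toNNReal, fun u G h => ?_⟩
  set C : ℝ≥0∞ := ((SNormLESNormFDerivOfEqConst ℝ
    (volume : Measure (EuclideanSpace ℝ (Fin N))) p.toNNReal : NNReal) : ℝ≥0∞) with hC
  obtain ⟨hu, hG, -, φ, hφ, h1, h2⟩ := h
  set s := ENNReal.ofReal (upperStar N p)
  set r := ENNReal.ofReal p
  have hs : 1 ≤ s := by simpa [s] using hps.le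
  have hr : 1 ≤ r := by simpa [r] using hp.le
  have hbound : ∀ n, eLpNorm u s ≤ eLpNorm (fun x => φ n x - u x) s volume +
      C * (eLpNorm (fun x => gradient (φ n) x - G x) r volume + eLpNorm G r) := by
    intro n
    have e1 : eLpNorm u s ≤ eLpNorm (fun x => φ n x - u x) s volume + eLpNorm (φ n) s := by
      have := eLpNorm_sub_le (μ := volume) (p := s) ((hφ n).memLp s).1
        (((hφ n).memLp s).sub hu).1 hs
      rw [sub_sub_cancel, add_comm] at this
      exact this
    have e2 : eLpNorm (φ n) s ≤ C * eLpNorm (gradient (φ n)) r := by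
      rw [eLpNorm_gradient]
      refine eLpNorm_le_eLpNorm_fderiv_of_eq volume ((hφ n).1.of_le (by simp)) (hφ n).2
        (p := p.toNNReal) (p' := (upperStar N p).toNNReal) ?_ ?_ ?_
      · rw [← NNReal.coe_le_coe]
        rw [Real.coe_toNNReal _ (by linarith)]
        exact hp.le
      · simp only [finrank_euclideanSpace, Fintype.card_fin]
        exact_mod_cast hN
      · rw [Real.coe_toNNReal _ (by linarith), NNReal.coe_inv,
          Real.coe_toNNReal _ (by linarith), upperStar]
        simp only [finrank_euclideanSpace, Fintype.card_fin]
        have : p ≠ 0 := by linarith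
        have : (N : ℝ) - p ≠ 0 := by linarith
        field_simp
    have e3 : eLpNorm (gradient (φ n)) r ≤
        eLpNorm (fun x => gradient (φ n) x - G x) r volume + eLpNorm G r := by
      have := eLpNorm_add_le (μ := volume) (p := r) (((hφ n).memLp_gradient r).sub hG).1 hG.1 hr
      rwa [sub_add_cancel] at this
    exact e1.trans (by gcongr; exact e2.trans (by gcongr))
  have hl : Tendsto (fun n => eLpNorm (fun x => φ n x - u x) s volume +
      C * (eLpNorm (fun x => gradient (φ n) x - G x) r volume + eLpNorm G r)) atTop
      (𝓝 (0 + C * (0 + eLpNorm G r))) :=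
    h1.add (ENNReal.Tendsto.const_mul (h2.add_const _) (Or.inr ENNReal.coe_ne_top))
  simpa using ge_of_tendsto hl (Eventually.of_forall hbound)

/-- Composition with a smooth function with derivative in `[0,1]` that vanishes at the origin. -/
lemma IsBeppoLevi.comp {p : ℝ} (hp : 1 < p) (hpN : p < N) {u : EuclideanSpace ℝ (Fin N) → ℝ}
    {G : EuclideanSpace ℝ (Fin N) → EuclideanSpace ℝ (Fin N)} (h : IsBeppoLevi p u G)
    {ψ : ℝ → ℝ} (hψ : ContDiff ℝ ∞ ψ) (hψ0 : ψ 0 = 0) (hψ' : ∀ t, deriv ψ t ∈ Set.Icc 0 1) :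
    IsBeppoLevi p (fun x => ψ (u x)) (fun x => deriv ψ (u x) • G x) := by
  have hps := one_lt_upperStar hp hpN
  obtain ⟨hu, hG, -, φ, hφ, h1, h2⟩ := h
  set s := ENNReal.ofReal (upperStar N p) with hsdef
  set r := ENNReal.ofReal p with hrdef
  have hs : 1 ≤ s := by simpa [s] using hps.le
  have hr : 1 ≤ r := by simpa [r] using hp.le
  have hdiff : Differentiable ℝ ψ := hψ.differentiable (by simp)
  have hcd : Continuous (deriv ψ) := hψ.continuous_deriv (by simp)
  have habs : ∀ t, |deriv ψ t| ≤ 1 := fun t => by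
    rw [abs_of_nonneg (hψ' t).1]; exact (hψ' t).2
  have hlip : LipschitzWith 1 ψ := lipschitzWith_of_nnnorm_deriv_le hdiff fun t => by
    rw [← NNReal.coe_le_coe]; simpa using habs t
  have hpsi : ∀ a b, |ψ a - ψ b| ≤ |a - b| := fun a b => by
    simpa [Real.dist_eq] using hlip.dist_le_mul a b
  have hmu : MemLp (fun x => ψ (u x)) s := by
    refine hu.mono (hψ.continuous.comp_aestronglyMeasurable hu.1) (Eventually.of_forall fun x => ?_)
    simpa [hψ0] using hpsi (u x) 0
  have hmd : AEStronglyMeasurable (fun x => deriv ψ (u x)) volume :=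
    hcd.comp_aestronglyMeasurable hu.1
  have hmG : MemLp (fun x => deriv ψ (u x) • G x) r := by
    refine hG.mono (hmd.smul hG.1) (Eventually.of_forall fun x => ?_)
    rw [norm_smul]
    exact mul_le_of_le_one_left (norm_nonneg _) (habs _)
  -- Norm convergence alone does not control `ψ'(φ n)`; along an a.e. convergent subsequence,
  -- continuity of `ψ'` gives pointwise convergence to `ψ'(u)`.
  obtain ⟨ns, hns, hae⟩ := (tendstoInMeasure_of_tendsto_eLpNorm (μ := volume) (p := s)
    (by positivity) (fun n => ((hφ n).memLp s).1) hu.1 h1).exists_seq_tendsto_ae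
  have htest : ∀ n, IsTestFunction (ψ ∘ φ (ns n)) := fun n =>
    ⟨hψ.comp (hφ _).1, (hφ _).2.comp_left hψ0⟩
  have l1 : Tendsto (fun n => eLpNorm (fun x => (ψ ∘ φ (ns n)) x - ψ (u x)) s volume)
      atTop (𝓝 0) := by
    refine tendsto_of_tendsto_of_tendsto_of_le_of_le tendsto_const_nhds
      (h1.comp hns.tendsto_atTop) (fun _ => zero_le) fun n => ?_
    exact eLpNorm_mono fun x => hpsi _ _
  have l2 : Tendsto (fun n => eLpNorm (fun x => gradient (ψ ∘ φ (ns n)) x - deriv ψ (u x) • G x)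
      r volume) atTop (𝓝 0) := by
    have hdom : Tendsto (fun n => eLpNorm (fun x => (deriv ψ (φ (ns n) x) - deriv ψ (u x)) • G x)
        r volume) atTop (𝓝 0) := by
      refine tendsto_eLpNorm_zero_of_dominated (g := fun x => 2 * ‖G x‖) (by positivity)
        ENNReal.ofReal_ne_top (fun n => ?_) (hG.norm.const_mul 2) (fun n => ?_) ?_
      · exact ((hcd.comp_aestronglyMeasurable ((hφ _).memLp s).1).sub hmd).smul hG.1
      · refine Eventually.of_forall fun x => ?_
        rw [norm_smul]
        refine mul_le_mul_of_nonneg_right ?_ (norm_nonneg _)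
        calc ‖deriv ψ (φ (ns n) x) - deriv ψ (u x)‖ ≤ ‖deriv ψ (φ (ns n) x)‖ + ‖deriv ψ (u x)‖ :=
              norm_sub_le _ _
          _ ≤ 2 := by
              have := habs (φ (ns n) x)
              have := habs (u x)
              simp only [Real.norm_eq_abs]; linarith
      · filter_upwards [hae] with x hx
        have h3 : Tendsto (fun n => deriv ψ (φ (ns n) x)) atTop (𝓝 (deriv ψ (u x))) :=
          (hcd.tendsto _).comp hx
        simpa using (h3.sub_const (deriv ψ (u x))).smul_const (G x)
    have hsum := (h2.comp hns.tendsto_atTop).add hdom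
    rw [add_zero] at hsum
    refine tendsto_of_tendsto_of_tendsto_of_le_of_le tendsto_const_nhds
      hsum (fun _ => zero_le) fun n => ?_
    have hd1 : AEStronglyMeasurable (fun x => deriv ψ (φ (ns n) x)) volume :=
      hcd.comp_aestronglyMeasurable ((hφ _).memLp s).1
    have hg1 : AEStronglyMeasurable (fun x => gradient (φ (ns n)) x - G x) volume :=
      (((hφ (ns n)).memLp_gradient r).sub hG).1
    -- The first summand is small by convergence of the gradients and `|ψ'| ≤ 1`, the second by
    -- dominated convergence with majorant `2|G|`.
    have e1 : (fun x => gradient (ψ ∘ φ (ns n)) x - deriv ψ (u x) • G x) =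
        (fun x => deriv ψ (φ (ns n) x) • (gradient (φ (ns n)) x - G x)) +
          fun x => (deriv ψ (φ (ns n) x) - deriv ψ (u x)) • G x := by
      ext1 x
      rw [gradient_comp ((hφ _).1.differentiable (by simp)) hdiff]
      simp only [Pi.add_apply, smul_sub, sub_smul]
      abel
    rw [e1]
    refine (eLpNorm_add_le (hd1.smul hg1) ((hd1.sub hmd).smul hG.1) hr).trans ?_
    refine add_le_add_left (eLpNorm_mono fun x => ?_) _
    rw [Pi.smul_apply', norm_smul]
    exact mul_le_of_le_one_left (norm_nonneg _) (habs _)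
  exact ⟨hmu, hmG, hasWeakGradient_of_tendsto hs hr hmu hmG htest l1 l2, _, htest, l1, l2⟩

end

/-! ### Energy estimates for truncations -/

section

variable {N : ℕ}

/-- No integrability is needed, since the Bochner integral of a non-integrable function is `0`. The
weak formulation can thus be moved to `ℝ≥0∞` without first showing that its right-hand side is
integrable. -/
lemma ofReal_integral_le_lintegral {α : Type*} [MeasurableSpace α] {μ : Measure α} (g : α → ℝ) :
    ENNReal.ofReal (∫ x, g x ∂μ) ≤ ∫⁻ x, ENNReal.ofReal (g x) ∂μ := by
  by_cases hg : Integrable g μ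
  · rw [integral_eq_lintegral_pos_part_sub_lintegral_neg_part hg]
    refine (ENNReal.ofReal_le_ofReal (sub_le_self _ ENNReal.toReal_nonneg)).trans ?_
    exact ENNReal.ofReal_toReal_le
  · simp [integral_undef hg]

lemma norm_rpow_mul_inner_smul {E : Type*} [NormedAddCommGroup E] [InnerProductSpace ℝ E] {p : ℝ}
    (hp : p ≠ 0) (v : E) (a : ℝ) :
    ‖v‖ ^ (p - 2) * inner ℝ v (a • v) = a * ‖v‖ ^ p := by
  rw [real_inner_smul_right, real_inner_self_eq_norm_sq]
  rcases eq_or_ne ‖v‖ 0 with h0 | h0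
  · simp [h0, Real.zero_rpow hp]
  · have : 0 < ‖v‖ := lt_of_le_of_ne (norm_nonneg _) h0.symm
    rw [Real.rpow_sub this, Real.rpow_two]
    field_simp

/-- Rests on `a^p ≤ a` for `a ∈ [0,1]` and `p > 1`. With `a = ψ'(u)`, the right side is the quantity
obtained by testing with `ψ(u)` and the left side is the one in the Sobolev inequality. -/
lemma eLpNorm_smul_rpow_le {α E : Type*} [MeasurableSpace α] {μ : Measure α}
    [NormedAddCommGroup E] [NormedSpace ℝ E] {p : ℝ} (hp : 1 < p) {a : α → ℝ} {G : α → E}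
    (ha : ∀ x, a x ∈ Set.Icc 0 1) (ham : AEStronglyMeasurable a μ)
    (hG : MemLp G (ENNReal.ofReal p) μ) :
    eLpNorm (fun x => a x • G x) (ENNReal.ofReal p) μ ^ p ≤
      ENNReal.ofReal (∫ x, a x * ‖G x‖ ^ p ∂μ) := by
  have hp0 : 0 < p := by linarith
  have hne0 : ENNReal.ofReal p ≠ 0 := by simpa using hp0
  have hGp : Integrable (fun x => a x * ‖G x‖ ^ p) μ := by
    have h1 := hG.integrable_norm_rpow hne0 ENNReal.ofReal_ne_top
    rw [ENNReal.toReal_ofReal hp0.le] at h1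
    refine h1.bdd_mul (c := 1) ham (Eventually.of_forall fun x => ?_)
    rw [Real.norm_eq_abs, abs_of_nonneg (ha _).1]
    exact (ha _).2
  rw [ofReal_integral_eq_lintegral_ofReal hGp (Eventually.of_forall fun x =>
    mul_nonneg (ha _).1 (Real.rpow_nonneg (norm_nonneg _) _)),
    eLpNorm_eq_lintegral_rpow_enorm_toReal hne0 ENNReal.ofReal_ne_top,
    ENNReal.toReal_ofReal hp0.le, ← ENNReal.rpow_mul, one_div, inv_mul_cancel₀ hp0.ne',
    ENNReal.rpow_one]
  refine lintegral_mono fun x => ?_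
  rw [← ofReal_norm, ENNReal.ofReal_rpow_of_nonneg (norm_nonneg _) hp0.le, norm_smul,
    Real.norm_eq_abs, abs_of_nonneg (ha _).1,
    Real.mul_rpow (ha _).1 (norm_nonneg _)]
  refine ENNReal.ofReal_le_ofReal (mul_le_mul_of_nonneg_right ?_ (by positivity))
  exact (Real.rpow_le_rpow_of_exponent_ge' (ha _).1 (ha _).2 zero_le_one hp.le).trans
    (Real.rpow_one _).le

/-- The energy estimate obtained by testing the equation with `ψ(u)`. -/
lemma IsSolution.exists_energy_smooth {p Λ : ℝ} (hp : 1 < p) (hpN : p < N)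
    {f u : EuclideanSpace ℝ (Fin N) → ℝ} (hu : IsSolution p Λ f u) :
    ∃ C : NNReal, ∀ ψ : ℝ → ℝ, ContDiff ℝ ∞ ψ → ψ 0 = 0 → (∀ t, deriv ψ t ∈ Set.Icc 0 1) →
      (∫⁻ x, ENNReal.ofReal (ψ (u x)) ^ upperStar N p) ^ (upperStar N p / p)⁻¹ ≤
        C * ((∫⁻ x, ENNReal.ofReal (f x) * ENNReal.ofReal (ψ (u x))) + ENNReal.ofReal |Λ| *
          ∫⁻ x, ENNReal.ofReal (u x) ^ (upperStar N p - 1) * ENNReal.ofReal (ψ (u x))) := by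
  have hps := one_lt_upperStar hp hpN
  have hp0 : 0 < p := by linarith
  obtain ⟨C, hC⟩ := IsBeppoLevi.exists_sobolev hp hpN
  obtain ⟨hpos, G, hG, htest⟩ := hu
  refine ⟨C ^ p, fun ψ hψ hψ0 hψ' => ?_⟩
  have hmono : Monotone ψ := monotone_of_deriv_nonneg (hψ.differentiable (by simp))
    fun t => (hψ' t).1
  have hcd : Continuous (deriv ψ) := hψ.continuous_deriv (by simp)
  have hψpos : ∀ᵐ x, 0 ≤ ψ (u x) := by
    filter_upwards [hpos] with x hx
    exact hψ0 ▸ hmono hx.le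
  have hB := hG.comp hp hpN hψ hψ0 hψ'
  have hS := hC _ _ hB
  have hT := (htest _ _ hB hψpos).2
  simp only [norm_rpow_mul_inner_smul (by linarith : p ≠ 0)] at hT
  have hne0' : ENNReal.ofReal (upperStar N p) ≠ 0 := by simp; linarith
  have hgrad := eLpNorm_smul_rpow_le hp (fun x => hψ' (u x))
    (hcd.comp_aestronglyMeasurable hG.1.1) hG.2.1
  have hlhs : (∫⁻ x, ENNReal.ofReal (ψ (u x)) ^ upperStar N p) ^ (upperStar N p / p)⁻¹ =
      eLpNorm (fun x => ψ (u x)) (ENNReal.ofReal (upperStar N p)) ^ p := by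
    rw [eLpNorm_eq_lintegral_rpow_enorm_toReal hne0' ENNReal.ofReal_ne_top,
      ENNReal.toReal_ofReal (by linarith), ← ENNReal.rpow_mul]
    congr 1
    · refine lintegral_congr_ae ?_
      filter_upwards [hψpos] with x hx
      rw [← ofReal_norm, Real.norm_of_nonneg hx]
    · field_simp
  rw [hlhs]
  refine (ENNReal.rpow_le_rpow hS hp0.le).trans ?_
  rw [ENNReal.mul_rpow_of_nonneg _ _ hp0.le, ← ENNReal.coe_rpow_of_nonneg _ hp0.le]
  refine mul_le_mul_right ?_ _
  refine hgrad.trans ((ENNReal.ofReal_le_ofReal hT).trans ?_)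
  refine ENNReal.ofReal_add_le.trans (add_le_add ?_ ?_)
  · refine (ofReal_integral_le_lintegral _).trans (le_of_eq (lintegral_congr_ae ?_))
    filter_upwards [hψpos] with x hx
    rw [ENNReal.ofReal_mul' hx]
  · have hnn : 0 ≤ ∫ x, u x ^ (upperStar N p - 1) * ψ (u x) := by
      refine integral_nonneg_of_ae ?_
      filter_upwards [hψpos, hpos] with x hx hx'
      exact mul_nonneg (Real.rpow_nonneg hx'.le _) hx
    refine (ENNReal.ofReal_le_ofReal
      (mul_le_mul_of_nonneg_right (le_abs_self Λ) hnn)).trans ?_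
    rw [ENNReal.ofReal_mul (abs_nonneg _)]
    gcongr
    refine (ofReal_integral_le_lintegral _).trans (le_of_eq (lintegral_congr_ae ?_))
    filter_upwards [hψpos, hpos] with x hx hx'
    rw [ENNReal.ofReal_mul' hx, ENNReal.ofReal_rpow_of_pos hx']

/-- Take `ψ n` to be the primitive of `η n`. Choosing `S = (k, ∞)` or `S = (-∞, k]` turns the limit
into `(t - k)₊` or `min(t, k)`. Approximation from below lets the right side of the energy estimate
be bounded by its limit at once. -/
lemma exists_smooth_approx {S : Set ℝ} (hS : MeasurableSet S) {η : ℕ → ℝ → ℝ}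
    (hη : ∀ n, ContDiff ℝ ∞ (η n)) (h0 : ∀ n s, 0 ≤ η n s) (h1 : ∀ n s, η n s ≤ S.indicator 1 s)
    (hlim : ∀ᵐ s, Tendsto (fun n => η n s) atTop (𝓝 (S.indicator 1 s))) :
    ∃ ψ : ℕ → ℝ → ℝ, (∀ n, ContDiff ℝ ∞ (ψ n)) ∧ (∀ n, ψ n 0 = 0) ∧
      (∀ n t, deriv (ψ n) t ∈ Set.Icc 0 1) ∧
      (∀ t, 0 ≤ t → ∀ n, ψ n t ≤ volume.real (Set.Ioc 0 t ∩ S)) ∧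
      (∀ t, 0 ≤ t → Tendsto (fun n => ψ n t) atTop (𝓝 (volume.real (Set.Ioc 0 t ∩ S)))) := by
  have hd : ∀ n t, HasDerivAt (fun t => ∫ s in (0 : ℝ)..t, η n s) (η n t) t := fun n t =>
    intervalIntegral.integral_hasDerivAt_right ((hη n).continuous.intervalIntegrable _ _)
      ((hη n).continuous.stronglyMeasurableAtFilter _ _) (hη n).continuous.continuousAt
  have hd' : ∀ n, deriv (fun t => ∫ s in (0 : ℝ)..t, η n s) = η n := fun n =>
    funext fun t => (hd n t).deriv
  have hval : ∀ t, 0 ≤ t → ∫ s in (0 : ℝ)..t, S.indicator (1 : ℝ → ℝ) s =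
      volume.real (Set.Ioc 0 t ∩ S) := fun t ht => by
    rw [intervalIntegral.integral_of_le ht, integral_indicator_one hS, measureReal_restrict_apply hS,
      Set.inter_comm]
  have hint : ∀ t, IntervalIntegrable (S.indicator (1 : ℝ → ℝ)) volume 0 t := fun t => by
    have h := intervalIntegrable_const (μ := volume) (a := 0) (b := t) (c := (1 : ℝ))
    rw [intervalIntegrable_iff] at h ⊢
    exact h.indicator hS
  have hle : ∀ s, S.indicator (1 : ℝ → ℝ) s ≤ 1 := fun s =>
    Set.indicator_le_self' (by simp) s
  refine ⟨fun n t => ∫ s in (0 : ℝ)..t, η n s, fun n => ?_, fun n => by simp, fun n t => ?_,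
    fun t ht n => ?_, fun t ht => ?_⟩
  · rw [contDiff_infty_iff_deriv, hd' n]
    exact ⟨fun t => (hd n t).differentiableAt, hη n⟩
  · rw [hd' n]
    exact ⟨h0 n t, (h1 n t).trans (hle t)⟩
  · rw [← hval t ht]
    exact intervalIntegral.integral_mono_on ht ((hη n).continuous.intervalIntegrable _ _) (hint t)
      fun s _ => h1 n s
  · rw [← hval t ht]
    refine intervalIntegral.tendsto_integral_filter_of_dominated_convergence (fun _ => 1)
      (Eventually.of_forall fun n => (hη n).continuous.aestronglyMeasurable)
      (Eventually.of_forall fun n => Eventually.of_forall fun s _ => ?_)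
      intervalIntegrable_const (hlim.mono fun s hs _ => hs)
    rw [Real.norm_of_nonneg (h0 n s)]
    exact (h1 n s).trans (hle s)

lemma tendsto_smoothTransition_nat_mul {s : ℝ} (hs : 0 < s) (c : ℝ) :
    Tendsto (fun n : ℕ => Real.smoothTransition (n * s + c)) atTop (𝓝 1) := by
  refine tendsto_const_nhds.congr' ?_
  have : Tendsto (fun n : ℕ => (n : ℝ) * s + c) atTop atTop :=
    tendsto_atTop_add_const_right _ _ (tendsto_natCast_atTop_atTop.atTop_mul_const hs)
  filter_upwards [this.eventually_ge_atTop 1] with n hn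
  exact (Real.smoothTransition.one_of_one_le hn).symm

lemma tendsto_smoothTransition_nat_mul_of_neg {s : ℝ} (hs : s < 0) (c : ℝ) :
    Tendsto (fun n : ℕ => Real.smoothTransition (n * s + c)) atTop (𝓝 0) := by
  refine tendsto_const_nhds.congr' ?_
  have : Tendsto (fun n : ℕ => (n : ℝ) * s + c) atTop atBot :=
    tendsto_atBot_add_const_right _ _ (tendsto_natCast_atTop_atTop.atTop_mul_const_of_neg hs)
  filter_upwards [this.eventually_le_atBot 0] with n hn
  exact (Real.smoothTransition.zero_of_nonpos hn).symm

lemma exists_smooth_approx_sub (k : ℝ) (hk : 0 ≤ k) :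
    ∃ ψ : ℕ → ℝ → ℝ, (∀ n, ContDiff ℝ ∞ (ψ n)) ∧ (∀ n, ψ n 0 = 0) ∧
      (∀ n t, deriv (ψ n) t ∈ Set.Icc 0 1) ∧ (∀ t, 0 ≤ t → ∀ n, ψ n t ≤ max (t - k) 0) ∧
      (∀ t, 0 ≤ t → Tendsto (fun n => ψ n t) atTop (𝓝 (max (t - k) 0))) := by
  have hval : ∀ t : ℝ, volume.real (Set.Ioc 0 t ∩ Set.Ioi k) = max (t - k) 0 := fun t => by
    rw [Set.Ioc_inter_Ioi, Real.volume_real_Ioc, max_eq_right hk]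
  simp only [← hval]
  refine exists_smooth_approx measurableSet_Ioi
    (η := fun n s => Real.smoothTransition (n * (s - k) + 0))
    (fun n => Real.smoothTransition.contDiff.comp (by fun_prop))
    (fun n s => Real.smoothTransition.nonneg _) (fun n s => ?_) (Eventually.of_forall fun s => ?_)
  · by_cases h : s ∈ Set.Ioi k
    · simpa [h] using Real.smoothTransition.le_one _
    · rw [Set.indicator_of_notMem h, Real.smoothTransition.zero_of_nonpos]
      have : s - k ≤ 0 := by simpa using h
      have := mul_nonpos_of_nonneg_of_nonpos (Nat.cast_nonneg (α := ℝ) n) this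
      linarith
  · by_cases h : s ∈ Set.Ioi k
    · rw [Set.indicator_of_mem h]
      exact tendsto_smoothTransition_nat_mul (sub_pos.2 h) 0
    · rw [Set.indicator_of_notMem h]
      have : s - k ≤ 0 := by simpa using h
      refine tendsto_const_nhds.congr fun n => (Real.smoothTransition.zero_of_nonpos ?_).symm
      have := mul_nonpos_of_nonneg_of_nonpos (Nat.cast_nonneg (α := ℝ) n) this
      linarith

lemma exists_smooth_approx_min (k : ℝ) (hk : 0 ≤ k) :
    ∃ ψ : ℕ → ℝ → ℝ, (∀ n, ContDiff ℝ ∞ (ψ n)) ∧ (∀ n, ψ n 0 = 0) ∧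
      (∀ n t, deriv (ψ n) t ∈ Set.Icc 0 1) ∧ (∀ t, 0 ≤ t → ∀ n, ψ n t ≤ min t k) ∧
      (∀ t, 0 ≤ t → Tendsto (fun n => ψ n t) atTop (𝓝 (min t k))) := by
  have hval : ∀ t : ℝ, 0 ≤ t → volume.real (Set.Ioc 0 t ∩ Set.Iic k) = min t k := fun t ht => by
    rw [Set.Ioc_inter_Iic, Real.volume_real_Ioc_of_le (le_min ht hk), sub_zero]
  have := exists_smooth_approx (measurableSet_Iic (a := k))
    -- The shift by `1` ends the transition at `s = k`, which keeps `η n` below the indicator; the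
    -- limit is then wrong at `s = k` only, a null set.
    (η := fun n s => 1 - Real.smoothTransition (n * (s - k) + 1))
    (fun n => contDiff_const.sub (Real.smoothTransition.contDiff.comp (by fun_prop)))
    (fun n s => sub_nonneg.2 (Real.smoothTransition.le_one _)) (fun n s => ?_) ?_
  · obtain ⟨ψ, a, b, c, d, e⟩ := this
    exact ⟨ψ, a, b, c, fun t ht n => hval t ht ▸ d t ht n, fun t ht => hval t ht ▸ e t ht⟩
  · by_cases h : s ∈ Set.Iic k
    · simpa [h] using Real.smoothTransition.nonneg _
    · rw [Set.indicator_of_notMem h, Real.smoothTransition.one_of_one_le, sub_self]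
      have : 0 ≤ s - k := by simpa using (not_le.1 h).le
      have := mul_nonneg (Nat.cast_nonneg (α := ℝ) n) this
      linarith
  · filter_upwards [(Set.countable_singleton k).ae_notMem volume] with s hs
    rcases lt_or_gt_of_ne (show s ≠ k from hs) with h | h
    · rw [Set.indicator_of_mem (show s ∈ Set.Iic k from h.le)]
      simpa using (tendsto_smoothTransition_nat_mul_of_neg (sub_neg.2 h) 1).const_sub 1
    · rw [Set.indicator_of_notMem (by simpa using h)]
      simpa using (tendsto_smoothTransition_nat_mul (sub_pos.2 h) 1).const_sub 1

/-- The energy estimates for the truncations of a solution from above and below. -/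
lemma IsSolution.exists_energy {p Λ : ℝ} (hp : 1 < p) (hpN : p < N)
    {f u : EuclideanSpace ℝ (Fin N) → ℝ} (hu : IsSolution p Λ f u) :
    ∃ C : NNReal, ∀ k : ℝ, 0 ≤ k →
      ((∫⁻ x, min (ENNReal.ofReal (u x)) (ENNReal.ofReal k) ^ upperStar N p) ^
          (upperStar N p / p)⁻¹ ≤
        C * ((∫⁻ x, ENNReal.ofReal (f x) * min (ENNReal.ofReal (u x)) (ENNReal.ofReal k)) +
          ENNReal.ofReal |Λ| * ∫⁻ x, ENNReal.ofReal (u x) ^ (upperStar N p - 1) *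
            min (ENNReal.ofReal (u x)) (ENNReal.ofReal k))) ∧
      ((∫⁻ x, (ENNReal.ofReal (u x) - ENNReal.ofReal k) ^ upperStar N p) ^
          (upperStar N p / p)⁻¹ ≤
        C * ((∫⁻ x, ENNReal.ofReal (f x) * (ENNReal.ofReal (u x) - ENNReal.ofReal k)) +
          ENNReal.ofReal |Λ| * ∫⁻ x, ENNReal.ofReal (u x) ^ (upperStar N p - 1) *
            (ENNReal.ofReal (u x) - ENNReal.ofReal k))) := by
  have hps := one_lt_upperStar hp hpN
  have hθ : 0 < upperStar N p / p := by
    have : 0 < p := by linarith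
    have : 0 < upperStar N p := by linarith
    positivity
  obtain ⟨C, hC⟩ := hu.exists_energy_smooth hp hpN
  have hpos := hu.1
  have hum : AEMeasurable u := hu.2.choose_spec.1.1.1.aemeasurable
  have key : ∀ w : ℝ → ℝ, (∃ ψ : ℕ → ℝ → ℝ, (∀ n, ContDiff ℝ ∞ (ψ n)) ∧ (∀ n, ψ n 0 = 0) ∧
      (∀ n t, deriv (ψ n) t ∈ Set.Icc 0 1) ∧ (∀ t, 0 ≤ t → ∀ n, ψ n t ≤ w t) ∧
      (∀ t, 0 ≤ t → Tendsto (fun n => ψ n t) atTop (𝓝 (w t)))) →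
      (∫⁻ x, ENNReal.ofReal (w (u x)) ^ upperStar N p) ^ (upperStar N p / p)⁻¹ ≤
        C * ((∫⁻ x, ENNReal.ofReal (f x) * ENNReal.ofReal (w (u x))) + ENNReal.ofReal |Λ| *
          ∫⁻ x, ENNReal.ofReal (u x) ^ (upperStar N p - 1) * ENNReal.ofReal (w (u x))) := by
    rintro w ⟨ψ, a, b, c, d, e⟩
    rw [ENNReal.rpow_inv_le_iff hθ]
    set R := (C * ((∫⁻ x, ENNReal.ofReal (f x) * ENNReal.ofReal (w (u x))) + ENNReal.ofReal |Λ| *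
          ∫⁻ x, ENNReal.ofReal (u x) ^ (upperStar N p - 1) * ENNReal.ofReal (w (u x)))) ^
          (upperStar N p / p) with hR
    have hn : ∀ n, ∫⁻ x, ENNReal.ofReal (ψ n (u x)) ^ upperStar N p ≤ R := fun n => by
      have h2 : ∀ᵐ x, ENNReal.ofReal (ψ n (u x)) ≤ ENNReal.ofReal (w (u x)) := by
        filter_upwards [hpos] with x hx
        exact ENNReal.ofReal_le_ofReal (d _ hx.le n)
      refine ((ENNReal.rpow_inv_le_iff hθ).1 (hC (ψ n) (a n) (b n) (c n))).trans ?_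
      rw [hR]
      refine ENNReal.rpow_le_rpow ?_ hθ.le
      refine mul_le_mul_right (add_le_add ?_ (mul_le_mul_right ?_ _)) _
      · exact lintegral_mono_ae (h2.mono fun x hx => by gcongr)
      · exact lintegral_mono_ae (h2.mono fun x hx => by gcongr)
    -- Fatou is needed on the left side only, since `R` already bounds every approximant.
    calc _ = ∫⁻ x, liminf (fun n => ENNReal.ofReal (ψ n (u x)) ^ upperStar N p) atTop := by
          refine lintegral_congr_ae ?_
          filter_upwards [hpos] with x hx
          exact (((ENNReal.continuous_rpow_const.comp ENNReal.continuous_ofReal).tendsto _).comp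
            (e _ hx.le)).liminf_eq.symm
      _ ≤ liminf (fun n => ∫⁻ x, ENNReal.ofReal (ψ n (u x)) ^ upperStar N p) atTop :=
          lintegral_liminf_le' fun n =>
            ((a n).continuous.measurable.comp_aemeasurable hum).ennreal_ofReal.pow_const _
      _ ≤ R := (liminf_le_liminf (Eventually.of_forall hn)).trans (by simp)
  refine ⟨C, fun k hk => ⟨?_, ?_⟩⟩
  · have := key _ (exists_smooth_approx_min k hk)
    simpa only [ENNReal.ofReal_min] using this
  · have := key _ (exists_smooth_approx_sub k hk)
    simpa only [ENNReal.ofReal_max, ENNReal.ofReal_sub _ hk, ENNReal.ofReal_zero,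
      max_eq_left zero_le] using this

end

/-! ### Absorption and a discrete Gronwall argument -/

lemma le_two_mul_of_le_add_half_mul {a b : ℝ≥0∞} (ha : a ≠ ⊤) (h : a ≤ b + 2⁻¹ * a) :
    a ≤ 2 * b := by
  rcases eq_or_ne b ⊤ with rfl | hb
  · simp
  lift a to NNReal using ha
  lift b to NNReal using hb
  have h2 : (2⁻¹ : ℝ≥0∞) = ((2⁻¹ : NNReal) : ℝ≥0∞) := by simp
  rw [h2] at h
  norm_cast at h ⊢
  rw [← NNReal.coe_le_coe] at h ⊢
  push_cast at h ⊢
  linarith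

/-- A nonnegative sequence with `m (k + 1) ≤ m k + D (2^{-(k+1)} m (k + 1)) ^ s m (k + 1)`
is bounded as soon as `m k = o(2^k)`. -/
lemma exists_bound_of_le_add_rpow_mul {m : ℕ → ℝ} {s D : ℝ} (hs : 0 < s) (hD : 0 ≤ D)
    (hm : ∀ k, 0 ≤ m k)
    (hrec : ∀ᶠ k in atTop, m (k + 1) ≤ m k + D * ((1 / 2) ^ (k + 1) * m (k + 1)) ^ s * m (k + 1))
    (hlim : Tendsto (fun k => (1 / 2) ^ k * m k) atTop (𝓝 0)) :
    ∃ B, ∀ᶠ k in atTop, m k ≤ B := by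
  have hsm : ∀ᶠ k in atTop, D * ((1 / 2) ^ k * m k) ^ s < 1 / 4 := by
    have h1 : Tendsto (fun k => D * ((1 / 2) ^ k * m k) ^ s) atTop (𝓝 (D * 0 ^ s)) :=
      ((Real.continuousAt_rpow_const 0 s (Or.inr hs.le)).tendsto.comp hlim).const_mul D
    rw [Real.zero_rpow hs.ne', mul_zero] at h1
    exact h1.eventually_lt_const (by norm_num)
  obtain ⟨K, hK⟩ := eventually_atTop.1 (hrec.and hsm)
  set t : ℕ → ℝ := fun j => D * ((1 / 2) ^ (K + j) * m (K + j)) ^ s with ht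
  set ρ : ℝ := (2 / 3) ^ s with hρ
  have hρ0 : 0 ≤ ρ := by positivity
  have hρ1 : ρ < 1 := Real.rpow_lt_one (by norm_num) (by norm_num) hs
  have ht0 : ∀ j, 0 ≤ t j := fun j => by
    have := hm (K + j)
    positivity
  have hstep : ∀ j, m (K + (j + 1)) ≤ m (K + j) + t (j + 1) * m (K + (j + 1)) := fun j =>
    (hK (K + j) (by omega)).1
  have ht4 : ∀ j, t j < 1 / 4 := fun j => (hK (K + j) (by omega)).2
  -- Growth by at most `4/3` against the factor `1/2` makes `2^(-k) m k` contract by `2/3`. The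
  -- increments `t j` therefore decay geometrically with ratio `ρ = (2/3)^s`, and the product of the
  -- growth factors converges.
  have h43 : ∀ j, m (K + (j + 1)) ≤ 4 / 3 * m (K + j) := fun j => by
    have := hstep j
    have := mul_le_mul_of_nonneg_right (ht4 (j + 1)).le (hm (K + (j + 1)))
    linarith
  have htdec : ∀ j, t (j + 1) ≤ ρ * t j := fun j => by
    have h1 : (1 / 2 : ℝ) ^ (K + (j + 1)) * m (K + (j + 1)) ≤
        2 / 3 * ((1 / 2) ^ (K + j) * m (K + j)) := by
      have := mul_le_mul_of_nonneg_left (h43 j) (by positivity : (0 : ℝ) ≤ (1 / 2) ^ (K + (j + 1)))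
      refine this.trans (le_of_eq ?_)
      rw [← add_assoc, pow_succ]
      ring
    have h0 := hm (K + j)
    have h0' := hm (K + (j + 1))
    calc t (j + 1) ≤ D * (2 / 3 * ((1 / 2) ^ (K + j) * m (K + j))) ^ s :=
          mul_le_mul_of_nonneg_left (Real.rpow_le_rpow (by positivity) h1 hs.le) hD
      _ = ρ * t j := by
          rw [Real.mul_rpow (by norm_num) (by positivity)]
          ring
  have htgeo : ∀ j, t j ≤ ρ ^ j := fun j => by
    induction j with
    | zero => simpa using (ht4 0).le.trans (by norm_num)
    | succ j ih =>
      rw [pow_succ']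
      exact (htdec j).trans (mul_le_mul_of_nonneg_left ih hρ0)
  have hexp : ∀ j, m (K + j) ≤ Real.exp (2 * ∑ i ∈ Finset.range (j + 1), ρ ^ i) * m K := fun j => by
    induction j with
    | zero =>
      refine le_mul_of_one_le_left (hm K) (Real.one_le_exp ?_)
      exact mul_nonneg (by norm_num) (Finset.sum_nonneg fun i _ => by positivity)
    | succ j ih =>
      have h1 : m (K + (j + 1)) ≤ (1 + 2 * t (j + 1)) * m (K + j) := by
        have a1 := hstep j
        have a2 := h43 j
        have a3 := mul_le_mul_of_nonneg_left a2 (ht0 (j + 1))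
        have a4 := mul_nonneg (ht0 (j + 1)) (hm (K + j))
        nlinarith
      have h2 : 1 + 2 * t (j + 1) ≤ Real.exp (2 * ρ ^ (j + 1)) := by
        have := Real.add_one_le_exp (2 * ρ ^ (j + 1))
        have := htgeo (j + 1)
        linarith
      rw [Finset.sum_range_succ, mul_add, Real.exp_add, mul_comm (Real.exp _), mul_assoc]
      exact h1.trans (mul_le_mul h2 ih (hm _) (Real.exp_nonneg _))
  refine ⟨Real.exp (2 * (1 - ρ)⁻¹) * m K, eventually_atTop.2 ⟨K, fun k hk => ?_⟩⟩
  obtain ⟨j, rfl⟩ := Nat.exists_eq_add_of_le hk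
  refine (hexp j).trans (mul_le_mul_of_nonneg_right (Real.exp_le_exp.2 ?_) (hm K))
  refine mul_le_mul_of_nonneg_left ?_ (by norm_num)
  rw [← tsum_geometric_of_lt_one hρ0 hρ1]
  exact (summable_geometric_of_lt_one hρ0 hρ1).sum_le_tsum _ fun i _ => by positivity

/-! ### The weak Lebesgue bound -/

section

variable {α : Type*} [MeasurableSpace α] {μ : Measure α} {U F : α → ℝ≥0∞} {P θ : ℝ}

lemma rpow_sub_one_mul_self {a : ℝ≥0∞} (hP : 1 ≤ P) : a ^ (P - 1) * a = a ^ P := by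
  conv_lhs => rw [← ENNReal.rpow_one a, ← ENNReal.rpow_mul, one_mul]
  rw [← ENNReal.rpow_add_of_nonneg _ _ (by linarith) zero_le_one, sub_add_cancel]

lemma rpow_mul_measure_lt_le_lintegral_min (hU : Measurable U) (hP : 0 ≤ P) (h : NNReal) :
    (h : ℝ≥0∞) ^ P * μ {x | (h : ℝ≥0∞) < U x} ≤ ∫⁻ x, min (U x) h ^ P ∂μ := by
  refine le_trans ?_ (mul_meas_ge_le_lintegral (μ := μ) ((hU.min measurable_const).pow_const P)
    ((h : ℝ≥0∞) ^ P))
  refine mul_le_mul_right (measure_mono fun x hx => ?_) _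
  exact ENNReal.rpow_le_rpow (le_min (le_of_lt hx) le_rfl) hP

lemma mul_setLIntegral_rpow_le (hU : Measurable U) (hP : 1 ≤ P) (h : NNReal) :
    (h : ℝ≥0∞) * ∫⁻ x in {x | (h : ℝ≥0∞) < U x}, U x ^ (P - 1) ∂μ ≤ ∫⁻ x, U x ^ P ∂μ := by
  have hm : MeasurableSet {x | (h : ℝ≥0∞) < U x} := measurableSet_lt measurable_const hU
  rw [← lintegral_const_mul _ (hU.pow_const _)]
  refine le_trans (setLIntegral_mono (hU.pow_const P) fun x hx => ?_) (setLIntegral_le_lintegral _ _)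
  rw [mul_comm, ← rpow_sub_one_mul_self hP]
  exact mul_le_mul_right (le_of_lt hx) _

/-- On `{h < U}` the integrand `h U^(P-1)` is dominated by `U^P`, and it tends to zero wherever `U`
is finite. This is the smallness that starts the dyadic iteration. -/
lemma tendsto_mul_setLIntegral_rpow (hU : Measurable U) (hP : 1 < P)
    (hUP : ∫⁻ x, U x ^ P ∂μ ≠ ⊤) {h : ℕ → NNReal} (hh : Tendsto h atTop (𝓝 0)) :
    Tendsto (fun n => (h n : ℝ≥0∞) * ∫⁻ x in {x | (h n : ℝ≥0∞) < U x}, U x ^ (P - 1) ∂μ) atTop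
      (𝓝 0) := by
  have hm : ∀ c : NNReal, MeasurableSet {x | (c : ℝ≥0∞) < U x} := fun c =>
    measurableSet_lt measurable_const hU
  have hfin : ∀ᵐ x ∂μ, U x ≠ ⊤ := by
    filter_upwards [ae_lt_top (hU.pow_const P) hUP] with x hx htop
    rw [htop, ENNReal.top_rpow_of_pos (by linarith)] at hx
    exact lt_irrefl _ hx
  have key : Tendsto (fun n => ∫⁻ x, {x | (h n : ℝ≥0∞) < U x}.indicator
      (fun x => (h n : ℝ≥0∞) * U x ^ (P - 1)) x ∂μ) atTop (𝓝 (∫⁻ _, 0 ∂μ)) := by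
    refine tendsto_lintegral_of_dominated_convergence (fun x => U x ^ P)
      (fun n => ((hU.pow_const _).const_mul _).indicator (hm _))
      (fun n => Eventually.of_forall fun x => ?_) hUP ?_
    · refine Set.indicator_apply_le' (fun hx => ?_) fun _ => zero_le
      beta_reduce
      rw [mul_comm, ← rpow_sub_one_mul_self hP.le]
      exact mul_le_mul_right (le_of_lt hx) _
    · filter_upwards [hfin] with x hx
      have h1 : Tendsto (fun n => (h n : ℝ≥0∞) * U x ^ (P - 1)) atTop (𝓝 0) := by
        have := ENNReal.Tendsto.mul_const (b := U x ^ (P - 1)) (ENNReal.tendsto_coe.2 hh)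
          (Or.inr (ENNReal.rpow_ne_top_of_nonneg (by linarith) hx))
        simpa using this
      refine tendsto_of_tendsto_of_tendsto_of_le_of_le tendsto_const_nhds h1
        (fun _ => zero_le) fun n => ?_
      exact Set.indicator_apply_le' (fun _ => le_rfl) fun _ => zero_le
  rw [lintegral_zero] at key
  refine key.congr fun n => ?_
  rw [lintegral_indicator (hm _), lintegral_const_mul _ (hU.pow_const _)]

lemma tendsto_lintegral_min_rpow (hU : Measurable U) (hP : 0 < P)
    (hUP : ∫⁻ x, U x ^ P ∂μ ≠ ⊤) {h : ℕ → NNReal} (hh : Tendsto h atTop (𝓝 0)) :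
    Tendsto (fun n => ∫⁻ x, min (U x) (h n) ^ P ∂μ) atTop (𝓝 0) := by
  have key : Tendsto (fun n => ∫⁻ x, min (U x) (h n) ^ P ∂μ) atTop (𝓝 (∫⁻ _, 0 ∂μ)) := by
    refine tendsto_lintegral_of_dominated_convergence (fun x => U x ^ P)
      (fun n => (hU.min measurable_const).pow_const _)
      (fun n => Eventually.of_forall fun x => ENNReal.rpow_le_rpow (min_le_left _ _) hP.le) hUP
      (Eventually.of_forall fun x => ?_)
    have h1 : Tendsto (fun n => min (U x) (h n : ℝ≥0∞)) atTop (𝓝 (min (U x) 0)) :=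
      tendsto_const_nhds.min (ENNReal.tendsto_coe.2 hh)
    have := ((ENNReal.continuous_rpow_const (y := P)).tendsto _).comp h1
    simpa [ENNReal.zero_rpow_of_pos hP, Function.comp_def] using this
  simpa using key

/-- On the dyadic layer `h < U ≤ 2h` the integrand is at most `(2h)^(P-1)`. -/
lemma setLIntegral_rpow_le_add (hU : Measurable U) (hP : 1 ≤ P) (h : NNReal) :
    ∫⁻ x in {x | (h : ℝ≥0∞) < U x}, U x ^ (P - 1) ∂μ ≤
      ∫⁻ x in {x | ((2 * h : NNReal) : ℝ≥0∞) < U x}, U x ^ (P - 1) ∂μ +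
        ((2 * h : NNReal) : ℝ≥0∞) ^ (P - 1) * μ {x | (h : ℝ≥0∞) < U x} := by
  have hm : ∀ c : NNReal, MeasurableSet {x | (c : ℝ≥0∞) < U x} := fun c =>
    measurableSet_lt measurable_const hU
  rw [← lintegral_indicator (hm _), ← lintegral_indicator (hm _), ← lintegral_indicator_const (hm _),
    ← lintegral_add_left ((hU.pow_const _).indicator (hm _))]
  refine lintegral_mono fun x => Set.indicator_apply_le (a := x) (g := fun x => _) fun hx => ?_
  by_cases h2 : x ∈ {x | ((2 * h : NNReal) : ℝ≥0∞) < U x}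
  · rw [Set.indicator_of_mem h2]
    exact le_self_add
  · rw [Set.indicator_of_notMem h2, Set.indicator_of_mem hx, zero_add]
    exact ENNReal.rpow_le_rpow (not_lt.1 h2) (by linarith)

lemma lintegral_rpow_sub_one_mul_min_le (hU : Measurable U) (hP : 1 ≤ P) (h : NNReal) :
    ∫⁻ x, U x ^ (P - 1) * min (U x) h ∂μ ≤ ∫⁻ x, min (U x) h ^ P ∂μ +
      h * ∫⁻ x in {x | (h : ℝ≥0∞) < U x}, U x ^ (P - 1) ∂μ := by
  have hm : MeasurableSet {x | (h : ℝ≥0∞) < U x} := measurableSet_lt measurable_const hU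
  rw [← lintegral_const_mul _ (hU.pow_const _), ← lintegral_indicator hm,
    ← lintegral_add_left ((hU.min measurable_const).pow_const _)]
  refine lintegral_mono fun x => ?_
  by_cases hx : x ∈ {x | (h : ℝ≥0∞) < U x}
  · rw [Set.indicator_of_mem hx, min_eq_right (le_of_lt hx), mul_comm]
    exact le_add_self
  · rw [Set.indicator_of_notMem hx, min_eq_left (not_lt.1 hx), rpow_sub_one_mul_self hP, add_zero]

/-- If the truncations `min(U, h)` satisfy an energy estimate of critical growth, then `U` belongs
to the weak Lebesgue space of exponent `P - θ`. -/
lemma exists_weak_bound_of_energy (hU : Measurable U) (hF : Measurable F) (hθ : 1 < θ) (hθP : θ < P)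
    (hUP : ∫⁻ x, U x ^ P ∂μ ≠ ⊤) (hF1 : ∫⁻ x, F x ∂μ ≠ ⊤) {C L : ℝ≥0∞} (hC : C ≠ ⊤) (hL : L ≠ ⊤)
    (hE : ∀ h : NNReal, (∫⁻ x, min (U x) h ^ P ∂μ) ^ θ⁻¹ ≤
      C * ((∫⁻ x, F x * min (U x) h ∂μ) + L * ∫⁻ x, U x ^ (P - 1) * min (U x) h ∂μ)) :
    ∃ D : ℝ≥0∞, D ≠ ⊤ ∧ ∀ h : NNReal, 0 < h →
      (h : ℝ≥0∞) ^ (P - θ) * μ {x | (h : ℝ≥0∞) < U x} ≤ D := by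
  have hP : 1 < P := hθ.trans hθP
  have hθ0 : 0 < θ := by linarith
  set A : NNReal → ℝ≥0∞ := fun h => ∫⁻ x, min (U x) h ^ P ∂μ with hA
  set M : NNReal → ℝ≥0∞ := fun h => ∫⁻ x in {x | (h : ℝ≥0∞) < U x}, U x ^ (P - 1) ∂μ with hM
  set I := ∫⁻ x, U x ^ P ∂μ with hI
  set F1 := ∫⁻ x, F x ∂μ with hF1'
  have hAI : ∀ h, A h ≤ I := fun h =>
    lintegral_mono fun x => ENNReal.rpow_le_rpow (min_le_left _ _) (by linarith)
  have hAtop : ∀ h, A h ≠ ⊤ := fun h => ne_top_of_le_ne_top hUP (hAI h)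
  have hAmono : ∀ {h k}, h ≤ k → A h ≤ A k := fun {h k} hk =>
    lintegral_mono fun x => ENNReal.rpow_le_rpow
      (min_le_min_left _ (ENNReal.coe_le_coe.2 hk)) (by linarith)
  have hManti : ∀ {h k}, h ≤ k → M k ≤ M h := fun {h k} hk =>
    lintegral_mono_set fun x hx => (ENNReal.coe_le_coe.2 hk).trans_lt hx
  have hMtop : ∀ {h}, 0 < h → M h ≠ ⊤ := fun {h} hh htop => by
    have := mul_setLIntegral_rpow_le (μ := μ) hU hP.le h
    rw [show (∫⁻ x in {x | (h : ℝ≥0∞) < U x}, U x ^ (P - 1) ∂μ) = ⊤ from htop,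
      ENNReal.mul_top (by simpa using hh.ne')] at this
    exact hUP (top_le_iff.1 this)
  set d : ℕ → NNReal := fun k => (1 / 2) ^ k with hd
  have hd0 : ∀ k, 0 < d k := fun k => by positivity
  have hdlim : Tendsto d atTop (𝓝 0) := tendsto_pow_atTop_nhds_zero_of_lt_one (by positivity)
    (by rw [← NNReal.coe_lt_coe]; norm_num)
  -- Writing `A = A^(1-1/θ) A^(1/θ)`, this makes the term `C L A(h)` at most half of the left side
  -- `A(h)^(1/θ)` for all `h ≤ d k₀`.
  obtain ⟨k₀, hk₀⟩ : ∃ k₀, C * L * A (d k₀) ^ (1 - θ⁻¹) ≤ 2⁻¹ := by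
    have hpos : 0 < 1 - θ⁻¹ := by
      have := inv_lt_one_of_one_lt₀ hθ
      linarith
    have h1 : Tendsto (fun k => C * L * A (d k) ^ (1 - θ⁻¹)) atTop (𝓝 0) := by
      have h2 := ((ENNReal.continuous_rpow_const (y := 1 - θ⁻¹)).tendsto 0).comp
        (tendsto_lintegral_min_rpow (μ := μ) hU (by linarith : 0 < P) hUP hdlim)
      rw [ENNReal.zero_rpow_of_pos hpos] at h2
      simpa using ENNReal.Tendsto.const_mul h2 (Or.inr (ENNReal.mul_ne_top hC hL))
    have h3 : ∀ᶠ k in atTop, C * L * A (d k) ^ (1 - θ⁻¹) < 2⁻¹ :=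
      h1.eventually_lt_const (by simp)
    exact ⟨_, h3.exists.choose_spec.le⟩
  set K : ℝ≥0∞ := 2 * (C * (F1 + L)) with hK
  have hKtop : K ≠ ⊤ := by finiteness
  have hmain : ∀ h, h ≤ d k₀ → A h ≤ (K * (h * (1 + M h))) ^ θ := fun h hh => by
    rw [← ENNReal.rpow_inv_le_iff hθ0, hK, mul_assoc]
    refine le_two_mul_of_le_add_half_mul
      (ENNReal.rpow_ne_top_of_nonneg (by positivity) (hAtop h)) ?_
    refine (hE h).trans ?_
    have hF' : ∫⁻ x, F x * min (U x) h ∂μ ≤ h * F1 := by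
      rw [hF1', ← lintegral_const_mul _ hF]
      refine lintegral_mono fun x => ?_
      rw [mul_comm]
      exact mul_le_mul_left (min_le_right _ _) _
    have hsplit : A h = A h ^ (1 - θ⁻¹) * A h ^ θ⁻¹ := by
      have := inv_lt_one_of_one_lt₀ hθ
      rw [← ENNReal.rpow_add_of_nonneg _ _ (by linarith) (by positivity), sub_add_cancel,
        ENNReal.rpow_one]
    have hsmall : C * L * A h ≤ 2⁻¹ * A h ^ θ⁻¹ := by
      have := inv_lt_one_of_one_lt₀ hθ
      calc C * L * A h = (C * L * A h ^ (1 - θ⁻¹)) * A h ^ θ⁻¹ := by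
            conv_lhs => rw [hsplit]
            ring
        _ ≤ _ := by
            refine mul_le_mul_left (le_trans ?_ hk₀) _
            exact mul_le_mul_right (ENNReal.rpow_le_rpow (hAmono hh) (by linarith)) _
    calc C * ((∫⁻ x, F x * min (U x) h ∂μ) + L * ∫⁻ x, U x ^ (P - 1) * min (U x) h ∂μ)
        ≤ C * (h * F1 + L * (A h + h * M h)) :=
          mul_le_mul_right (add_le_add hF'
            (mul_le_mul_right (lintegral_rpow_sub_one_mul_min_le hU hP.le h) _)) _
      _ = C * (h * F1 + L * (h * M h)) + C * L * A h := by ring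
      _ ≤ C * (F1 + L) * (h * (1 + M h)) + 2⁻¹ * A h ^ θ⁻¹ := by
          refine add_le_add ?_ hsmall
          rw [mul_assoc]
          refine mul_le_mul_right ?_ _
          -- The cross terms are added to reach a product, so that source and tail are controlled by
          -- the single quantity `1 + M h`.
          calc h * F1 + L * (h * M h) ≤ h * F1 + L * (h * M h) + (h * F1 * M h + L * h) :=
                le_self_add
            _ = (F1 + L) * (h * (1 + M h)) := by ring
  have hmeas : ∀ h, h ≤ d k₀ →
      (h : ℝ≥0∞) ^ P * μ {x | (h : ℝ≥0∞) < U x} ≤ (K * (h * (1 + M h))) ^ θ := fun h hh =>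
    (rpow_mul_measure_lt_le_lintegral_min hU (by linarith) h).trans (hmain h hh)
  clear_value K
  set D : ℝ≥0∞ := 2 ^ (P - 1) * K ^ θ with hD
  have hDtop : D ≠ ⊤ := ENNReal.mul_ne_top (ENNReal.rpow_ne_top_of_nonneg (by linarith) (by simp))
    (ENNReal.rpow_ne_top_of_nonneg (by linarith) hKtop)
  have hlayer : ∀ h, 0 < h → h ≤ d k₀ → ((2 * h : NNReal) : ℝ≥0∞) ^ (P - 1) *
      μ {x | (h : ℝ≥0∞) < U x} ≤ D * (h * (1 + M h)) ^ (θ - 1) * (1 + M h) := fun h h0 hh => by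
    have hne : (h : ℝ≥0∞) ≠ 0 := by simpa using h0.ne'
    -- After multiplication by `h` the left side is `2^(P-1) h^P |{U > h}|`, and one factor `h (1 +
    -- M h)` splits off the power `θ` on the right.
    rw [← ENNReal.mul_le_mul_iff_right hne ENNReal.coe_ne_top]
    calc (h : ℝ≥0∞) * (((2 * h : NNReal) : ℝ≥0∞) ^ (P - 1) * μ {x | (h : ℝ≥0∞) < U x})
        = 2 ^ (P - 1) * ((h : ℝ≥0∞) ^ P * μ {x | (h : ℝ≥0∞) < U x}) := by
          rw [← rpow_sub_one_mul_self hP.le, ENNReal.coe_mul,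
            ENNReal.mul_rpow_of_nonneg _ _ (by linarith), ENNReal.coe_ofNat]
          ring
      _ ≤ 2 ^ (P - 1) * (K * (h * (1 + M h))) ^ θ := mul_le_mul_right (hmeas h hh) _
      _ = _ := by
          rw [ENNReal.mul_rpow_of_nonneg _ _ hθ0.le,
            ← rpow_sub_one_mul_self (a := h * (1 + M h)) hθ.le, hD]
          ring
  clear_value D
  have hmtop : ∀ k, 1 + M (d k) ≠ ⊤ := fun k => ENNReal.add_ne_top.2 ⟨by simp, hMtop (hd0 k)⟩
  obtain ⟨B, hB⟩ := exists_bound_of_le_add_rpow_mul (m := fun k => (1 + M (d k)).toReal)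
    (s := θ - 1) (D := D.toReal) (by linarith) ENNReal.toReal_nonneg
    (fun k => ENNReal.toReal_nonneg) (by
      filter_upwards [eventually_ge_atTop k₀] with k hk
      have hdk : d (k + 1) ≤ d k₀ := pow_le_pow_of_le_one (by positivity)
        (by rw [← NNReal.coe_le_coe]; norm_num) (by omega)
      have h2d : 2 * d (k + 1) = d k := by
        simp only [hd, pow_succ]
        rw [mul_comm, mul_assoc, one_div, inv_mul_cancel₀ two_ne_zero, mul_one]
      have h1 := setLIntegral_rpow_le_add (μ := μ) hU hP.le (d (k + 1))
      have h3 := hlayer _ (hd0 (k + 1)) hdk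
      have h4 : 1 + M (d (k + 1)) ≤ 1 + M (d k) +
          D * (d (k + 1) * (1 + M (d (k + 1)))) ^ (θ - 1) * (1 + M (d (k + 1))) := by
        rw [add_assoc]
        refine add_le_add_right ?_ 1
        refine h1.trans (add_le_add (le_of_eq ?_) h3)
        rw [h2d]
      have h5 : D * (d (k + 1) * (1 + M (d (k + 1)))) ^ (θ - 1) * (1 + M (d (k + 1))) ≠ ⊤ := by
        refine ENNReal.mul_ne_top (ENNReal.mul_ne_top hDtop ?_) (hmtop _)
        exact ENNReal.rpow_ne_top_of_nonneg (by linarith)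
          (ENNReal.mul_ne_top ENNReal.coe_ne_top (hmtop _))
      have h6 := ENNReal.toReal_mono (ENNReal.add_ne_top.2 ⟨hmtop k, h5⟩) h4
      rw [ENNReal.toReal_add (hmtop k) h5, ENNReal.toReal_mul, ENNReal.toReal_mul,
        ← ENNReal.toReal_rpow, ENNReal.toReal_mul] at h6
      simpa [hd] using h6) (by
      have h1 : Tendsto (fun k => (d k : ℝ≥0∞) * (1 + M (d k))) atTop (𝓝 0) := by
        have := (ENNReal.tendsto_coe.2 hdlim).add
          (tendsto_mul_setLIntegral_rpow (μ := μ) hU hP hUP hdlim)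
        simp only [ENNReal.coe_zero, add_zero] at this
        refine this.congr fun k => ?_
        rw [mul_add, mul_one]
      have := (ENNReal.tendsto_toReal ENNReal.zero_ne_top).comp h1
      simpa [Function.comp_def, hd] using this)
  obtain ⟨k₁, hk₁⟩ := eventually_atTop.1 hB
  -- `M` is nonincreasing in `h`, so a bound along the dyadic levels suffices.
  have hMB : ∀ h, 0 < h → 1 + M h ≤ ENNReal.ofReal B := fun h h0 => by
    obtain ⟨k, hk, hk'⟩ := ((hdlim.eventually_lt_const h0).and (eventually_ge_atTop k₁)).exists
    refine (add_le_add_right (hManti hk.le) 1).trans ?_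
    rw [← ENNReal.ofReal_toReal (hmtop k)]
    exact ENNReal.ofReal_le_ofReal (hk₁ k hk')
  -- The first summand serves `h ≤ d k₀`, where absorption works; the second serves larger `h`,
  -- where `A h ≤ I` is enough.
  refine ⟨(K * ENNReal.ofReal B) ^ θ + (d k₀ : ℝ≥0∞) ^ (-θ) * I, ?_, fun h h0 => ?_⟩
  · refine ENNReal.add_ne_top.2 ⟨ENNReal.rpow_ne_top_of_nonneg hθ0.le (by finiteness),
      ENNReal.mul_ne_top (ENNReal.rpow_ne_top_of_ne_zero ?_ ENNReal.coe_ne_top) hUP⟩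
    simpa using (hd0 k₀).ne'
  have hne : (h : ℝ≥0∞) ≠ 0 := by simpa using h0.ne'
  have hsplit : (h : ℝ≥0∞) ^ (P - θ) * μ {x | (h : ℝ≥0∞) < U x} =
      (h : ℝ≥0∞) ^ (-θ) * ((h : ℝ≥0∞) ^ P * μ {x | (h : ℝ≥0∞) < U x}) := by
    rw [← mul_assoc, ← ENNReal.rpow_add _ _ hne ENNReal.coe_ne_top]
    ring_nf
  rw [hsplit]
  rcases le_total h (d k₀) with hh | hh
  · refine le_trans ?_ le_self_add
    calc _ ≤ (h : ℝ≥0∞) ^ (-θ) * (K * (h * ENNReal.ofReal B)) ^ θ :=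
          mul_le_mul_right ((hmeas h hh).trans (ENNReal.rpow_le_rpow
            (mul_le_mul_right (mul_le_mul_right (hMB h h0) _) _) hθ0.le)) _
      _ = ((h : ℝ≥0∞) ^ (-θ) * (h : ℝ≥0∞) ^ θ) * (K * ENNReal.ofReal B) ^ θ := by
          rw [mul_left_comm K (h : ℝ≥0∞), ENNReal.mul_rpow_of_nonneg _ _ hθ0.le, mul_assoc]
      _ = _ := by
          rw [← ENNReal.rpow_add _ _ hne ENNReal.coe_ne_top]
          simp
  · refine le_trans ?_ le_add_self
    refine mul_le_mul' ?_
      ((rpow_mul_measure_lt_le_lintegral_min hU (by linarith) h).trans (hAI h))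
    rw [ENNReal.rpow_neg, ENNReal.rpow_neg, ENNReal.inv_le_inv]
    exact ENNReal.rpow_le_rpow (ENNReal.coe_le_coe.2 hh) hθ0.le

end

/-! ### De Giorgi iteration and essential boundedness -/

/-- Fast geometric convergence: a sequence with `y (n + 1) ≤ D b ^ n y n ^ (1 + δ)` tends to zero
if its first term is small enough. -/
lemma exists_pos_tendsto_zero_of_le_mul_rpow {D b δ : ℝ} (hD : 0 ≤ D) (hb : 1 < b) (hδ : 0 < δ) :
    ∃ ε > 0, ∀ y : ℕ → ℝ, (∀ n, 0 ≤ y n) →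
      (∀ n, y n ≤ 1 → y (n + 1) ≤ D * b ^ n * y n ^ (1 + δ)) → y 0 ≤ ε →
      Tendsto y atTop (𝓝 0) := by
  have hb0 : 0 < b := by linarith
  set r : ℝ := b ^ (-δ⁻¹) with hr
  have hr0 : 0 < r := Real.rpow_pos_of_pos hb0 _
  have hr1 : r < 1 := Real.rpow_lt_one_of_one_lt_of_neg hb (by simpa using hδ)
  have hbr : b * r ^ δ = 1 := by
    rw [hr, ← Real.rpow_mul hb0.le, neg_mul, inv_mul_cancel₀ hδ.ne', Real.rpow_neg_one,
      mul_inv_cancel₀ hb0.ne']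
  -- With this threshold `D y₀^δ ≤ r`, and `b r^δ = 1` by the choice of `r`; hence the bound `y n ≤
  -- y₀ r^n` reproduces itself. The minimum with `1` keeps the sequence where the recursion is
  -- available.
  refine ⟨min 1 ((r / (D + 1)) ^ δ⁻¹), by positivity, fun y hy hrec h0 => ?_⟩
  have hy1 : y 0 ≤ 1 := h0.trans (min_le_left _ _)
  have hDy : D * y 0 ^ δ ≤ r := by
    have h1 : y 0 ^ δ ≤ r / (D + 1) := by
      have := Real.rpow_le_rpow (hy 0) (h0.trans (min_le_right _ _)) hδ.le
      rwa [← Real.rpow_mul (by positivity), inv_mul_cancel₀ hδ.ne', Real.rpow_one] at this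
    rw [le_div_iff₀ (by positivity)] at h1
    have := Real.rpow_nonneg (hy 0) δ
    linarith
  have hmain : ∀ n, y n ≤ y 0 * r ^ n := fun n => by
    induction n with
    | zero => simp
    | succ n ih =>
      have hrn : r ^ n ≤ 1 := pow_le_one₀ hr0.le hr1.le
      have hyn : y n ≤ 1 := ih.trans (mul_le_one₀ hy1 (by positivity) hrn)
      have hyr : 0 ≤ y 0 * r ^ n := mul_nonneg (hy 0) (by positivity)
      calc y (n + 1) ≤ D * b ^ n * y n ^ (1 + δ) := hrec n hyn
        _ ≤ D * b ^ n * (y 0 * r ^ n) ^ (1 + δ) :=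
            mul_le_mul_of_nonneg_left (Real.rpow_le_rpow (hy n) ih (by positivity)) (by positivity)
        _ = (D * y 0 ^ δ) * (b * r ^ δ) ^ n * (y 0 * r ^ n) := by
            rw [add_comm, Real.rpow_add_one' hyr (by positivity), Real.mul_rpow (hy 0) (by positivity),
              mul_pow, ← Real.rpow_natCast (r ^ δ), ← Real.rpow_mul hr0.le, ← Real.rpow_natCast r,
              ← Real.rpow_mul hr0.le, mul_comm δ]
            ring
        _ ≤ r * 1 * (y 0 * r ^ n) := by
            rw [hbr, one_pow]
            exact mul_le_mul_of_nonneg_right (by linarith) hyr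
        _ = y 0 * r ^ (n + 1) := by ring
  refine squeeze_zero hy hmain ?_
  simpa using (tendsto_pow_atTop_nhds_zero_of_lt_one hr0.le hr1).const_mul (y 0)

section

variable {α : Type*} [MeasurableSpace α] {μ : Measure α} {U F : α → ℝ≥0∞} {P θ : ℝ}

lemma tendsto_lintegral_sub_rpow (hU : Measurable U) (hP : 0 < P)
    (hUP : ∫⁻ x, U x ^ P ∂μ ≠ ⊤) {h : ℕ → NNReal} (hh : Tendsto h atTop atTop) :
    Tendsto (fun n => ∫⁻ x, (U x - h n) ^ P ∂μ) atTop (𝓝 0) := by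
  have hfin : ∀ᵐ x ∂μ, U x ≠ ⊤ := by
    filter_upwards [ae_lt_top (hU.pow_const P) hUP] with x hx htop
    rw [htop, ENNReal.top_rpow_of_pos hP] at hx
    exact lt_irrefl _ hx
  have key : Tendsto (fun n => ∫⁻ x, (U x - h n) ^ P ∂μ) atTop (𝓝 (∫⁻ _, 0 ∂μ)) := by
    refine tendsto_lintegral_of_dominated_convergence (fun x => U x ^ P)
      (fun n => (hU.sub_const _).pow_const _)
      (fun n => Eventually.of_forall fun x => ENNReal.rpow_le_rpow tsub_le_self hP.le) hUP ?_
    filter_upwards [hfin] with x hx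
    refine tendsto_const_nhds.congr' ?_
    filter_upwards [hh.eventually_ge_atTop (U x).toNNReal] with n hn
    have : U x ≤ h n := by
      rw [← ENNReal.coe_toNNReal hx]
      exact ENNReal.coe_le_coe.2 hn
    rw [tsub_eq_zero_of_le this, ENNReal.zero_rpow_of_pos hP]
  simpa using key

lemma rpow_mul_measure_lt_le_lintegral_sub (hU : Measurable U) (hP : 0 ≤ P) (k h : NNReal) :
    (h : ℝ≥0∞) ^ P * μ {x | ((k + h : NNReal) : ℝ≥0∞) < U x} ≤ ∫⁻ x, (U x - k) ^ P ∂μ := by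
  refine le_trans ?_ (mul_meas_ge_le_lintegral (μ := μ) ((hU.sub_const _).pow_const P)
    ((h : ℝ≥0∞) ^ P))
  refine mul_le_mul_right (measure_mono fun x hx => ?_) _
  refine ENNReal.rpow_le_rpow (ENNReal.le_sub_of_add_le_left ENNReal.coe_ne_top ?_) hP
  rw [← ENNReal.coe_add]
  exact le_of_lt hx

lemma lintegral_sub_le (hU : Measurable U) (hP : 1 < P) (k : NNReal) :
    ∫⁻ x, (U x - k) ∂μ ≤
      (∫⁻ x, (U x - k) ^ P ∂μ) ^ P⁻¹ * μ {x | (k : ℝ≥0∞) < U x} ^ (1 - P⁻¹) := by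
  have hm : MeasurableSet {x | (k : ℝ≥0∞) < U x} := measurableSet_lt measurable_const hU
  have h1 := ENNReal.lintegral_mul_norm_pow_le (μ := μ) (p := P⁻¹) (q := 1 - P⁻¹)
    ((hU.sub_const k).pow_const P).aemeasurable
    ((measurable_const (a := (1 : ℝ≥0∞))).indicator hm).aemeasurable (by positivity)
    (by have := inv_lt_one_of_one_lt₀ hP; linarith) (by ring)
  rw [lintegral_indicator_const hm, one_mul] at h1
  refine le_trans (lintegral_mono fun x => ?_) h1
  rw [← ENNReal.rpow_mul, mul_inv_cancel₀ (by linarith), ENNReal.rpow_one]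
  by_cases hx : x ∈ {x | (k : ℝ≥0∞) < U x}
  · rw [Set.indicator_of_mem hx, ENNReal.one_rpow, mul_one]
  · rw [tsub_eq_zero_of_le (not_lt.1 hx)]
    exact zero_le

/-- Hölder with three factors, the third being the indicator of `{U > k}`, outside which the
integrand vanishes. -/
lemma lintegral_mul_sub_le (hU : Measurable U) (hF : Measurable F) {q : ℝ} (hP : 0 < P)
    (hq : 0 < q) (hPq : P⁻¹ + q⁻¹ ≤ 1) (k : NNReal) :
    ∫⁻ x, F x * (U x - k) ∂μ ≤ (∫⁻ x, F x ^ q ∂μ) ^ q⁻¹ * (∫⁻ x, (U x - k) ^ P ∂μ) ^ P⁻¹ *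
      μ {x | (k : ℝ≥0∞) < U x} ^ (1 - P⁻¹ - q⁻¹) := by
  have hm : MeasurableSet {x | (k : ℝ≥0∞) < U x} := measurableSet_lt measurable_const hU
  have h1 := ENNReal.lintegral_prod_norm_pow_le (μ := μ) Finset.univ
    (f := ![fun x => F x ^ q, fun x => (U x - k) ^ P,
      {x | (k : ℝ≥0∞) < U x}.indicator fun _ => 1])
    (p := ![q⁻¹, P⁻¹, 1 - P⁻¹ - q⁻¹])
    (by
      intro i _
      fin_cases i
      · exact (hF.pow_const q).aemeasurable
      · exact ((hU.sub_const k).pow_const P).aemeasurable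
      · exact (measurable_const.indicator hm).aemeasurable)
    (by simp [Fin.sum_univ_three]; ring)
    (by
      intro i _
      fin_cases i
      · simpa using hq.le
      · simpa using hP.le
      · simp only [Fin.reduceFinMk, Matrix.cons_val]
        linarith)
  simp only [Fin.prod_univ_three, Matrix.cons_val_zero, Matrix.cons_val_one,
    Matrix.cons_val] at h1
  rw [lintegral_indicator_const hm, one_mul] at h1
  refine le_trans (lintegral_mono fun x => ?_) h1
  rw [← ENNReal.rpow_mul, mul_inv_cancel₀ hq.ne', ENNReal.rpow_one,
    ← ENNReal.rpow_mul, mul_inv_cancel₀ hP.ne', ENNReal.rpow_one]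
  by_cases hx : x ∈ {x | (k : ℝ≥0∞) < U x}
  · rw [Set.indicator_of_mem hx, ENNReal.one_rpow, mul_one]
  · rw [tsub_eq_zero_of_le (not_lt.1 hx), mul_zero]
    exact zero_le

lemma rpow_sub_one_mul_tsub_le (hP : 1 ≤ P) (a k : ℝ≥0∞) :
    a ^ (P - 1) * (a - k) ≤ 2 ^ (P - 1) * ((a - k) ^ P + k ^ (P - 1) * (a - k)) := by
  have hP' : 0 ≤ P - 1 := by linarith
  rw [← rpow_sub_one_mul_self (a := a - k) hP, ← add_mul, ← mul_assoc]
  refine mul_le_mul_left ?_ _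
  calc a ^ (P - 1) ≤ (2 * max (a - k) k) ^ (P - 1) := by
        refine ENNReal.rpow_le_rpow ?_ hP'
        rw [two_mul]
        exact le_tsub_add.trans (add_le_add (le_max_left _ _) (le_max_right _ _))
    _ = 2 ^ (P - 1) * max (a - k) k ^ (P - 1) := ENNReal.mul_rpow_of_nonneg _ _ hP'
    _ ≤ _ := by
        refine mul_le_mul_right ?_ _
        rcases max_cases (a - k) k with ⟨h, -⟩ | ⟨h, -⟩ <;> rw [h]
        · exact le_self_add
        · exact le_add_self

/-- If the truncations `(U - k)₊` satisfy an energy estimate of critical growth with right-hand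
side in a supercritical Lebesgue space, then `U` is essentially bounded (De Giorgi iteration). -/
lemma exists_ae_bound_of_energy (hU : Measurable U) (hF : Measurable F) (hθ : 1 < θ) (hθP : θ < P)
    {q : ℝ} (hq : 0 < q) (hqθ : q⁻¹ < 1 - θ⁻¹)
    (hUP : ∫⁻ x, U x ^ P ∂μ ≠ ⊤) (hFq : ∫⁻ x, F x ^ q ∂μ ≠ ⊤) {C L : ℝ≥0∞} (hC : C ≠ ⊤) (hL : L ≠ ⊤)
    (hE : ∀ k : NNReal, (∫⁻ x, (U x - k) ^ P ∂μ) ^ θ⁻¹ ≤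
      C * ((∫⁻ x, F x * (U x - k) ∂μ) + L * ∫⁻ x, U x ^ (P - 1) * (U x - k) ∂μ)) :
    ∃ K : NNReal, μ {x | (K : ℝ≥0∞) < U x} = 0 := by
  have hP : 1 < P := hθ.trans hθP
  have hP0 : 0 < P := by linarith
  have hθ0 : 0 < θ := by linarith
  have hPθ : P⁻¹ < θ⁻¹ := (inv_lt_inv₀ hP0 hθ0).2 hθP
  have hθ1 : θ⁻¹ < 1 := inv_lt_one_of_one_lt₀ hθ
  have hPi : 0 < P⁻¹ := by positivity
  have hqi : 0 < q⁻¹ := by positivity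
  -- `a` is the power of `|{U > k}|` produced by Hölder, and `κ` is the power of `I k` left after
  -- dividing the energy estimate by `I k ^ P⁻¹`. The condition `q⁻¹ < 1 - θ⁻¹` says exactly `κ <
  -- a`, which makes the iteration superlinear.
  set a : ℝ := 1 - P⁻¹ - q⁻¹ with ha
  set κ : ℝ := θ⁻¹ - P⁻¹ with hκ
  have hκ0 : 0 < κ := by linarith
  have haκ : κ < a := by linarith
  have ha0 : 0 < a := by linarith
  set I : NNReal → ℝ≥0∞ := fun k => ∫⁻ x, (U x - k) ^ P ∂μ with hI
  have hItop : ∀ k, I k ≠ ⊤ := fun k => ne_top_of_le_ne_top hUP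
    (lintegral_mono fun x => ENNReal.rpow_le_rpow tsub_le_self hP0.le)
  have hIanti : ∀ {h k}, h ≤ k → I k ≤ I h := fun {h k} hk =>
    lintegral_mono fun x => ENNReal.rpow_le_rpow
      (tsub_le_tsub_left (ENNReal.coe_le_coe.2 hk) _) hP0.le
  set Φ : ℝ≥0∞ := (∫⁻ x, F x ^ q ∂μ) ^ q⁻¹ with hΦ
  have hΦtop : Φ ≠ ⊤ := ENNReal.rpow_ne_top_of_nonneg hqi.le hFq
  set c : ℝ≥0∞ := 2 ^ (P - 1) with hc
  have hctop : c ≠ ⊤ := ENNReal.rpow_ne_top_of_nonneg (by linarith) (by simp)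
  have hIlim := tendsto_lintegral_sub_rpow (μ := μ) hU hP0 hUP
    (tendsto_natCast_atTop_atTop (R := NNReal))
  obtain ⟨n₀, hn₀⟩ : ∃ n₀ : ℕ, C * (L * c) * I n₀ ^ (1 - θ⁻¹) ≤ 2⁻¹ := by
    have h2 := ((ENNReal.continuous_rpow_const (y := 1 - θ⁻¹)).tendsto 0).comp hIlim
    rw [ENNReal.zero_rpow_of_pos (by linarith)] at h2
    have h1 := ENNReal.Tendsto.const_mul h2
      (Or.inr (ENNReal.mul_ne_top hC (ENNReal.mul_ne_top hL hctop)))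
    rw [mul_zero] at h1
    have h3 := h1.eventually_lt_const (show (0 : ℝ≥0∞) < 2⁻¹ by simp)
    exact ⟨_, h3.exists.choose_spec.le⟩
  have habsorb : ∀ k : NNReal, (n₀ : NNReal) ≤ k → I k ^ θ⁻¹ ≤
      2 * (C * ((∫⁻ x, F x * (U x - k) ∂μ) +
        L * c * ((k : ℝ≥0∞) ^ (P - 1) * ∫⁻ x, (U x - k) ∂μ))) := fun k hk => by
    refine le_two_mul_of_le_add_half_mul
      (ENNReal.rpow_ne_top_of_nonneg (by positivity) (hItop k)) ?_
    refine (hE k).trans ?_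
    have h1 : ∫⁻ x, U x ^ (P - 1) * (U x - k) ∂μ ≤
        c * (I k + (k : ℝ≥0∞) ^ (P - 1) * ∫⁻ x, (U x - k) ∂μ) := by
      rw [← lintegral_const_mul _ (hU.sub_const _), ← lintegral_add_left
        ((hU.sub_const _).pow_const _), ← lintegral_const_mul' _ _ hctop]
      exact lintegral_mono fun x => rpow_sub_one_mul_tsub_le hP.le _ _
    have hsplit : I k = I k ^ (1 - θ⁻¹) * I k ^ θ⁻¹ := by
      rw [← ENNReal.rpow_add_of_nonneg _ _ (by linarith) (by positivity), sub_add_cancel,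
        ENNReal.rpow_one]
    have hsmall : C * (L * c) * I k ≤ 2⁻¹ * I k ^ θ⁻¹ := by
      calc C * (L * c) * I k = (C * (L * c) * I k ^ (1 - θ⁻¹)) * I k ^ θ⁻¹ := by
            conv_lhs => rw [hsplit]
            ring
        _ ≤ _ := by
            refine mul_le_mul_left (le_trans ?_ hn₀) _
            exact mul_le_mul_right (ENNReal.rpow_le_rpow (hIanti hk) (by linarith)) _
    refine (mul_le_mul_right (add_le_add_right (mul_le_mul_right h1 L) _) C).trans ?_
    refine le_trans (le_of_eq ?_) (add_le_add_right hsmall _)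
    ring
  have hest : ∀ k : NNReal, (n₀ : NNReal) ≤ k → I k ^ κ ≤
      2 * (C * (Φ * μ {x | (k : ℝ≥0∞) < U x} ^ a +
        L * c * ((k : ℝ≥0∞) ^ (P - 1) * μ {x | (k : ℝ≥0∞) < U x} ^ (1 - P⁻¹)))) := fun k hk => by
    rcases eq_or_ne (I k) 0 with h0 | h0
    · rw [h0, ENNReal.zero_rpow_of_pos hκ0]
      exact zero_le
    have hJ0 : I k ^ P⁻¹ ≠ 0 := by simp [h0, hP0.not_gt]
    have hJ : I k ^ P⁻¹ ≠ ⊤ := ENNReal.rpow_ne_top_of_nonneg hPi.le (hItop k)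
    rw [← ENNReal.mul_le_mul_iff_right hJ0 hJ, ← ENNReal.rpow_add_of_nonneg _ _ hPi.le hκ0.le,
      hκ, add_sub_cancel]
    refine (habsorb k hk).trans ?_
    calc _ ≤ 2 * (C * (Φ * I k ^ P⁻¹ * μ {x | (k : ℝ≥0∞) < U x} ^ a +
        L * c * ((k : ℝ≥0∞) ^ (P - 1) *
          (I k ^ P⁻¹ * μ {x | (k : ℝ≥0∞) < U x} ^ (1 - P⁻¹))))) := by
          refine mul_le_mul_right (mul_le_mul_right (add_le_add
            (lintegral_mul_sub_le hU hF hP0 hq (by linarith) k) ?_) _) _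
          exact mul_le_mul_right (mul_le_mul_right (lintegral_sub_le hU hP k) _) _
      _ = _ := by ring
  set X : ℝ≥0∞ := 2 * (C * (Φ + L * c * c)) with hX
  have hXtop : X ≠ ⊤ := by finiteness
  -- The weight `K^P` absorbs `k^(P-1)`, because `P (1 - 1/P) = P - 1`. Since the weighted measure
  -- is at most `1` and `a ≤ 1 - 1/P`, both terms reduce to the power `a`, with `X` independent of
  -- `K`.
  have hdecay : ∀ K k : NNReal, 1 ≤ K → (n₀ : NNReal) ≤ K → K ≤ k → k ≤ 2 * K →
      (K : ℝ≥0∞) ^ P * μ {x | (k : ℝ≥0∞) < U x} ≤ 1 →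
      I k ≤ (X * ((K : ℝ≥0∞) ^ P * μ {x | (k : ℝ≥0∞) < U x}) ^ a) ^ κ⁻¹ := by
    intro K k hK1 hK hKk hk2 hy
    rw [ENNReal.le_rpow_inv_iff hκ0]
    refine (hest k (hK.trans hKk)).trans ?_
    set m := μ {x | (k : ℝ≥0∞) < U x} with hm
    have e1 : m ^ a ≤ ((K : ℝ≥0∞) ^ P * m) ^ a := by
      refine ENNReal.rpow_le_rpow (le_mul_of_one_le_left' ?_) ha0.le
      exact ENNReal.one_le_rpow (by exact_mod_cast hK1) hP0
    have e2 : (k : ℝ≥0∞) ^ (P - 1) * m ^ (1 - P⁻¹) ≤ c * ((K : ℝ≥0∞) ^ P * m) ^ a := by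
      calc (k : ℝ≥0∞) ^ (P - 1) * m ^ (1 - P⁻¹)
          ≤ ((2 * K : NNReal) : ℝ≥0∞) ^ (P - 1) * m ^ (1 - P⁻¹) :=
            mul_le_mul_left (ENNReal.rpow_le_rpow (ENNReal.coe_le_coe.2 hk2) (by linarith)) _
        _ = c * ((K : ℝ≥0∞) ^ P * m) ^ (1 - P⁻¹) := by
            rw [ENNReal.mul_rpow_of_nonneg _ _ (by linarith), ← ENNReal.rpow_mul, ENNReal.coe_mul,
              ENNReal.mul_rpow_of_nonneg _ _ (by linarith), ENNReal.coe_ofNat,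
              show P * (1 - P⁻¹) = P - 1 by field_simp, mul_assoc]
        _ ≤ _ := mul_le_mul_right (ENNReal.rpow_le_rpow_of_exponent_ge hy (by linarith)) _
    calc _ ≤ 2 * (C * (Φ * ((K : ℝ≥0∞) ^ P * m) ^ a + L * c * (c * ((K : ℝ≥0∞) ^ P * m) ^ a))) :=
          mul_le_mul_right (mul_le_mul_right (add_le_add (mul_le_mul_right e1 _)
            (mul_le_mul_right e2 _)) _) _
      _ = _ := by rw [hX]; ring
  clear_value X
  set D : ℝ := 2 ^ P * X.toReal ^ κ⁻¹ with hD
  obtain ⟨ε, hε, hiter⟩ := exists_pos_tendsto_zero_of_le_mul_rpow (D := D) (b := 2 ^ P)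
    (δ := a / κ - 1) (by positivity) (Real.one_lt_rpow one_lt_two hP0)
    (by rw [sub_pos, one_lt_div hκ0]; exact haκ)
  obtain ⟨n, hn1, hn2⟩ : ∃ n : ℕ, n₀ + 1 ≤ n ∧ 2 ^ P * I n ≤ ENNReal.ofReal ε := by
    have h0 := ENNReal.Tendsto.const_mul (a := (2 : ℝ≥0∞) ^ P) hIlim
      (Or.inr (ENNReal.rpow_ne_top_of_nonneg hP0.le (by simp)))
    rw [mul_zero] at h0
    have := h0.eventually_le_const (show (0 : ℝ≥0∞) < ENNReal.ofReal ε by simpa using hε)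
    obtain ⟨n, h1, h2⟩ := (this.and (eventually_ge_atTop (n₀ + 1))).exists
    exact ⟨n, h2, h1⟩
  -- With `K = 2n`, Chebyshev at level `n` gives `K^P |{U > K}| ≤ 2^P I(n)`, which is below the
  -- threshold `ε`.
  set K : NNReal := n + n with hK
  have hnK : (n : NNReal) ≤ K := le_self_add
  have hn1' : (n₀ : NNReal) + 1 ≤ n := by exact_mod_cast hn1
  have hK1 : 1 ≤ K := (le_add_self.trans hn1').trans hnK
  have hKn₀ : (n₀ : NNReal) ≤ K := (le_self_add.trans hn1').trans hnK
  have hKne : (K : ℝ≥0∞) ^ P ≠ 0 := (zero_lt_one.trans_le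
    (ENNReal.one_le_rpow (by exact_mod_cast hK1) hP0)).ne'
  have hKtop : (K : ℝ≥0∞) ^ P ≠ ⊤ := ENNReal.rpow_ne_top_of_nonneg hP0.le ENNReal.coe_ne_top
  have hstart : (K : ℝ≥0∞) ^ P * μ {x | (K : ℝ≥0∞) < U x} ≤ ENNReal.ofReal ε := by
    refine le_trans ?_ hn2
    refine le_trans (le_of_eq ?_) (mul_le_mul_right
      (rpow_mul_measure_lt_le_lintegral_sub (μ := μ) hU hP0.le n n) _)
    rw [← mul_assoc, ← ENNReal.mul_rpow_of_nonneg _ _ hP0.le, hK, ENNReal.coe_add, two_mul]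
  -- These levels are `K (2 - 2^(-j))`; the gaps `K 2^(-(j+1))` cost the factor `(2^P)^(j+1)` in
  -- Chebyshev's inequality.
  set l : ℕ → NNReal := fun j => K * ∑ i ∈ Finset.range (j + 1), (1 / 2) ^ i with hl
  have hlsucc : ∀ j, l (j + 1) = l j + K * (1 / 2) ^ (j + 1) := fun j => by
    simp only [hl]
    rw [Finset.sum_range_succ _ (j + 1), mul_add]
  have hl2 : ∀ j, l j + K * (1 / 2) ^ j = 2 * K := fun j => by
    induction j with
    | zero => simp [hl, two_mul]
    | succ j ih =>
      rw [hlsucc, ← ih, add_assoc]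
      congr 1
      rw [← mul_add, ← two_mul, pow_succ', ← mul_assoc 2]
      simp
  have hl2' : ∀ j, l j ≤ 2 * K := fun j => hl2 j ▸ le_self_add
  have hKl : ∀ j, K ≤ l j := fun j => by
    refine le_mul_of_one_le_right' ?_
    rw [Finset.sum_range_succ', pow_zero]
    exact le_add_self
  set Y : ℕ → ℝ≥0∞ := fun j => (K : ℝ≥0∞) ^ P * μ {x | (l j : ℝ≥0∞) < U x} with hY
  have hYε : ∀ j, Y j ≤ ENNReal.ofReal ε := fun j =>
    (mul_le_mul_right (measure_mono fun x hx => (ENNReal.coe_le_coe.2 (hKl j)).trans_lt hx) _).trans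
      hstart
  have hYtop : ∀ j, Y j ≠ ⊤ := fun j => ne_top_of_le_ne_top ENNReal.ofReal_ne_top (hYε j)
  have hstep : ∀ j, Y j ≤ 1 → Y (j + 1) ≤ 2 ^ P * X ^ κ⁻¹ * (2 ^ P) ^ j * Y j ^ (a / κ) := by
    intro j hj
    have h1 := hdecay K (l j) hK1 hKn₀ (hKl j) (hl2' j) hj
    have h2 := (rpow_mul_measure_lt_le_lintegral_sub (μ := μ) hU hP0.le (l j)
      (K * (1 / 2) ^ (j + 1))).trans h1
    rw [← hlsucc] at h2
    have h3 : (K : ℝ≥0∞) ^ P = (2 ^ P) ^ (j + 1) *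
        ((K * (1 / 2) ^ (j + 1) : NNReal) : ℝ≥0∞) ^ P := by
      rw [← ENNReal.rpow_natCast ((2 : ℝ≥0∞) ^ P), ← ENNReal.rpow_mul, mul_comm P,
        ENNReal.rpow_mul, ← ENNReal.mul_rpow_of_nonneg _ _ hP0.le, ENNReal.rpow_natCast]
      congr 1
      have h4 : ((2 : NNReal) ^ (j + 1)) * (K * (1 / 2) ^ (j + 1)) = K := by
        rw [mul_left_comm, ← mul_pow]
        simp
      have h5 := congrArg ((↑) : NNReal → ℝ≥0∞) h4
      rw [ENNReal.coe_mul, ENNReal.coe_pow, ENNReal.coe_ofNat] at h5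
      exact h5.symm
    calc Y (j + 1) = (2 ^ P) ^ (j + 1) * (((K * (1 / 2) ^ (j + 1) : NNReal) : ℝ≥0∞) ^ P *
          μ {x | (l (j + 1) : ℝ≥0∞) < U x}) := by
          rw [← mul_assoc, ← h3]
      _ ≤ (2 ^ P) ^ (j + 1) * (X * Y j ^ a) ^ κ⁻¹ := mul_le_mul_right h2 _
      _ = _ := by
          rw [ENNReal.mul_rpow_of_nonneg _ _ (by positivity), ← ENNReal.rpow_mul, pow_succ,
            ← div_eq_mul_inv]
          ring
  have hlim := hiter (fun j => (Y j).toReal) (fun _ => ENNReal.toReal_nonneg) (fun j hj => by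
      have hj' : Y j ≤ 1 := by
        rw [← ENNReal.ofReal_toReal (hYtop j)]
        exact ENNReal.ofReal_le_one.2 hj
      have h1 := ENNReal.toReal_mono ?_ (hstep j hj')
      · generalize Y (j + 1) = z at h1 ⊢
        generalize Y j = w at h1 ⊢
        rw [ENNReal.toReal_mul, ENNReal.toReal_mul, ENNReal.toReal_mul, ENNReal.toReal_pow,
          ← ENNReal.toReal_rpow, ← ENNReal.toReal_rpow, ← ENNReal.toReal_rpow] at h1
        simpa [hD] using h1
      · have t1 : (2 : ℝ≥0∞) ^ P ≠ ⊤ := ENNReal.rpow_ne_top_of_nonneg hP0.le (by simp)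
        refine ENNReal.mul_ne_top (ENNReal.mul_ne_top (ENNReal.mul_ne_top t1 ?_)
          (ENNReal.pow_ne_top t1)) ?_
        · exact ENNReal.rpow_ne_top_of_nonneg (by positivity) hXtop
        · exact ENNReal.rpow_ne_top_of_nonneg (by positivity) (hYtop j))
    (ENNReal.toReal_le_of_le_ofReal hε.le (hYε 0))
  refine ⟨2 * K, ?_⟩
  have hle : ∀ j, (K : ℝ≥0∞) ^ P * μ {x | ((2 * K : NNReal) : ℝ≥0∞) < U x} ≤ Y j := fun j =>
    mul_le_mul_right (measure_mono fun x hx => (ENNReal.coe_le_coe.2 (hl2' j)).trans_lt hx) _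
  have hlim' : Tendsto Y atTop (𝓝 0) := by
    have := ENNReal.tendsto_ofReal hlim
    simpa [ENNReal.ofReal_toReal (hYtop _)] using this
  have hzero := le_antisymm (ge_of_tendsto' hlim' hle) zero_le
  exact (mul_eq_zero.1 hzero).resolve_left hKne

end

/-! ### Integrability exponents -/

/-- Reduces `q ∈ (t, ∞]` to a finite exponent: for `q = ∞`, the bound `f₊^(t+1) ≤ ‖f‖_∞^t |f|`
interpolates with `L^1`. -/
lemma exists_lintegral_rpow_ne_top {α : Type*} [MeasurableSpace α] {μ : Measure α} {f : α → ℝ}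
    {q : ℝ≥0∞} {t : ℝ} (ht : 1 ≤ t) (hq : ENNReal.ofReal t < q) (hf1 : MemLp f 1 μ)
    (hfq : MemLp f q μ) :
    ∃ r : ℝ, t < r ∧ ∫⁻ x, ENNReal.ofReal (f x) ^ r ∂μ ≠ ⊤ := by
  have hle : ∀ x, ENNReal.ofReal (f x) ≤ ‖f x‖ₑ := fun x => by
    rw [← ofReal_norm]
    exact ENNReal.ofReal_le_ofReal (Real.le_norm_self _)
  rcases eq_or_ne q ⊤ with rfl | hqt
  · refine ⟨t + 1, by linarith, ?_⟩
    have h1 : ∫⁻ x, ‖f x‖ₑ ∂μ ≠ ⊤ := by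
      rw [← eLpNorm_one_eq_lintegral_enorm]
      exact hf1.2.ne
    have h2 : eLpNorm f ⊤ μ ≠ ⊤ := hfq.2.ne
    have h3 : eLpNorm f ⊤ μ ^ t * ∫⁻ x, ‖f x‖ₑ ∂μ ≠ ⊤ :=
      ENNReal.mul_ne_top (ENNReal.rpow_ne_top_of_nonneg (by linarith) h2) h1
    refine ne_top_of_le_ne_top h3 ?_
    rw [← lintegral_const_mul' _ _ (ENNReal.rpow_ne_top_of_nonneg (by linarith) h2)]
    refine lintegral_mono_ae ?_
    filter_upwards [ae_le_eLpNormEssSup (f := f) (μ := μ)] with x hx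
    rw [← rpow_sub_one_mul_self (by linarith), add_sub_cancel_right]
    refine mul_le_mul' (ENNReal.rpow_le_rpow ((hle x).trans ?_) (by linarith)) (hle x)
    rwa [eLpNorm_exponent_top]
  · have hq0 : q ≠ 0 := (zero_le.trans_lt hq).ne'
    refine ⟨q.toReal, ?_, ?_⟩
    · rwa [ENNReal.ofReal_lt_iff_lt_toReal (by linarith) hqt] at hq
    · refine ne_top_of_le_ne_top
        ((eLpNorm_lt_top_iff_lintegral_rpow_enorm_lt_top hq0 hqt).1 hfq.2).ne ?_
      exact lintegral_mono fun x => ENNReal.rpow_le_rpow (hle x) ENNReal.toReal_nonneg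

/-- A bounded function in weak `L^s` belongs to `L^r` for every finite `r > s`. -/
lemma lintegral_rpow_lt_top_of_weak_bound {α : Type*} [MeasurableSpace α] {μ : Measure α}
    {u : α → ℝ} (hu0 : 0 ≤ᵐ[μ] u) (hu : AEMeasurable u μ) {s r : ℝ} (hs : 0 < s) (hsr : s < r)
    {D : ℝ≥0∞} (hD : D ≠ ⊤) (hw : ∀ t : ℝ, 0 < t → ENNReal.ofReal t ^ s * μ {x | t < u x} ≤ D)
    {K : ℝ} (hK : μ {x | K < u x} = 0) :
    ∫⁻ x, ENNReal.ofReal (u x ^ r) ∂μ < ⊤ := by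
  have hr : 0 < r := hs.trans hsr
  rw [lintegral_rpow_eq_lintegral_meas_lt_mul μ hu0 hu hr]
  refine ENNReal.mul_lt_top ENNReal.ofReal_lt_top ?_
  set K' := max K 0
  -- The layer-cake integral stops at `K'` because `u` is bounded, and near zero the weak bound
  -- leaves `t^(r-1-s)`, integrable since `r > s`.
  have hle : ∫⁻ t in Set.Ioi (0 : ℝ), μ {x | t < u x} * ENNReal.ofReal (t ^ (r - 1)) ≤
      ∫⁻ t in Set.Ioc 0 K', D * ENNReal.ofReal (t ^ (r - 1 - s)) := by
    rw [← lintegral_indicator measurableSet_Ioi, ← lintegral_indicator measurableSet_Ioc]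
    refine lintegral_mono fun t => Set.indicator_apply_le' (fun ht => ?_) fun _ => zero_le
    have ht0 : 0 < t := ht
    by_cases htK : t ≤ K'
    · rw [Set.indicator_of_mem (show t ∈ Set.Ioc 0 K' from ⟨ht0, htK⟩)]
      have h1 : t ^ (r - 1) = t ^ s * t ^ (r - 1 - s) := by
        rw [← Real.rpow_add ht0]
        ring_nf
      rw [h1, ENNReal.ofReal_mul (by positivity), ← ENNReal.ofReal_rpow_of_pos ht0, ← mul_assoc,
        mul_comm (μ _)]
      exact mul_le_mul_left (hw t ht0) _
    · have : μ {x | t < u x} = 0 := measure_mono_null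
        (fun x hx => (le_max_left K 0).trans_lt ((not_le.1 htK).trans hx)) hK
      rw [this, zero_mul]
      exact zero_le
  refine hle.trans_lt ?_
  rw [lintegral_const_mul' _ _ hD]
  refine ENNReal.mul_lt_top hD.lt_top ?_
  have hint := intervalIntegral.intervalIntegrable_rpow' (a := 0) (b := K')
    (show -1 < r - 1 - s by linarith)
  rw [intervalIntegrable_iff_integrableOn_Ioc_of_le (le_max_right _ _)] at hint
  refine lt_of_le_of_lt (lintegral_ofReal_le_lintegral_enorm _) hint.2

/-! ### Application to the solution and conclusion -/

section

variable {N : ℕ}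

lemma IsSolution.exists_bounds {p Λ : ℝ} (hp : 1 < p) (hpN : p < N)
    {q : ℝ≥0∞} (hq : ENNReal.ofReal (N / p) < q) {f u : EuclideanSpace ℝ (Fin N) → ℝ}
    (hf_one : MemLp f 1) (hf_q : MemLp f q) (hu : IsSolution p Λ f u) :
    ∃ D : ℝ≥0∞, D ≠ ⊤ ∧ (∀ t : ℝ, 0 < t →
      ENNReal.ofReal t ^ (lowerStar N p - 1) * volume {x | t < u x} ≤ D) ∧
      ∃ K : ℝ, volume {x | K < u x} = 0 := by
  have hN : 0 < (N : ℝ) := by linarith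
  have hNp : 0 < (N : ℝ) - p := by linarith
  have hp0 : 0 < p := by linarith
  set P := upperStar N p with hP
  set θ := P / p with hθ
  have hθ' : θ = N / (N - p) := by
    rw [hθ, hP, upperStar]
    field_simp
  have hθ1 : 1 < θ := by
    rw [hθ', one_lt_div hNp]
    linarith
  have hP0 : 0 < P := by
    rw [hP, upperStar]
    positivity
  have hθP : θ < P := div_lt_self hP0 hp
  have hs : lowerStar N p - 1 = P - θ := by
    rw [hθ', hP, upperStar, lowerStar]
    field_simp
    ring
  obtain ⟨C, hC⟩ := hu.exists_energy hp hpN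
  obtain ⟨G, hG, -⟩ := hu.2
  have hum : AEMeasurable u := hG.1.1.aemeasurable
  obtain ⟨r, hr, hfr⟩ := exists_lintegral_rpow_ne_top (by rw [one_le_div hp0]; exact hpN.le)
    hq hf_one hf_q
  have hr0 : 0 < r := lt_trans (by positivity) hr
  have hrθ : r⁻¹ < 1 - θ⁻¹ := by
    have h1 : 1 - θ⁻¹ = (N / p : ℝ)⁻¹ := by
      rw [hθ']
      field_simp
      ring
    rw [h1]
    exact (inv_lt_inv₀ hr0 (by positivity)).2 hr
  have hf1 : ∫⁻ x, ENNReal.ofReal (f x) ≠ ⊤ := by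
    refine ne_top_of_le_ne_top ?_ (lintegral_ofReal_le_lintegral_enorm f)
    rw [← eLpNorm_one_eq_lintegral_enorm]
    exact hf_one.2.ne
  have huP : ∫⁻ x, ENNReal.ofReal (u x) ^ P ≠ ⊤ := by
    have := (eLpNorm_lt_top_iff_lintegral_rpow_enorm_lt_top (by simpa using hP0)
      ENNReal.ofReal_ne_top).1 hG.1.2
    rw [ENNReal.toReal_ofReal hP0.le] at this
    refine ne_top_of_le_ne_top this.ne (lintegral_mono fun x => ENNReal.rpow_le_rpow ?_ hP0.le)
    rw [← ofReal_norm]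
    exact ENNReal.ofReal_le_ofReal (Real.le_norm_self _)
  have hUm := hum.ennreal_ofReal
  have hFm := hf_one.1.aemeasurable.ennreal_ofReal
  -- The abstract bounds are stated for measurable functions, so `u₊` and `f₊` are replaced by
  -- measurable representatives.
  obtain ⟨U, hU, hUu⟩ := hUm
  obtain ⟨F, hF, hFf⟩ := hFm
  have hE : ∀ k : NNReal,
      ((∫⁻ x, min (U x) k ^ P) ^ θ⁻¹ ≤ C * ((∫⁻ x, F x * min (U x) k) +
        ENNReal.ofReal |Λ| * ∫⁻ x, U x ^ (P - 1) * min (U x) k)) ∧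
      ((∫⁻ x, (U x - k) ^ P) ^ θ⁻¹ ≤ C * ((∫⁻ x, F x * (U x - k)) +
        ENNReal.ofReal |Λ| * ∫⁻ x, U x ^ (P - 1) * (U x - k))) := fun k => by
    have h := hC k k.2
    simp only [ENNReal.ofReal_coe_nnreal] at h
    have c1 : ∫⁻ x, min (U x) k ^ P = ∫⁻ x, min (ENNReal.ofReal (u x)) k ^ P :=
      lintegral_congr_ae (by filter_upwards [hUu] with x hx; rw [hx])
    have c2 : ∫⁻ x, F x * min (U x) k =
        ∫⁻ x, ENNReal.ofReal (f x) * min (ENNReal.ofReal (u x)) k :=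
      lintegral_congr_ae (by filter_upwards [hUu, hFf] with x hx hy; rw [hx, hy])
    have c3 : ∫⁻ x, U x ^ (P - 1) * min (U x) k =
        ∫⁻ x, ENNReal.ofReal (u x) ^ (P - 1) * min (ENNReal.ofReal (u x)) k :=
      lintegral_congr_ae (by filter_upwards [hUu] with x hx; rw [hx])
    have c4 : ∫⁻ x, (U x - k) ^ P = ∫⁻ x, (ENNReal.ofReal (u x) - k) ^ P :=
      lintegral_congr_ae (by filter_upwards [hUu] with x hx; rw [hx])
    have c5 : ∫⁻ x, F x * (U x - k) =
        ∫⁻ x, ENNReal.ofReal (f x) * (ENNReal.ofReal (u x) - k) :=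
      lintegral_congr_ae (by filter_upwards [hUu, hFf] with x hx hy; rw [hx, hy])
    have c6 : ∫⁻ x, U x ^ (P - 1) * (U x - k) =
        ∫⁻ x, ENNReal.ofReal (u x) ^ (P - 1) * (ENNReal.ofReal (u x) - k) :=
      lintegral_congr_ae (by filter_upwards [hUu] with x hx; rw [hx])
    rw [c1, c2, c3, c4, c5, c6]
    exact h
  have hUP : ∫⁻ x, U x ^ P ≠ ⊤ := by
    rwa [lintegral_congr_ae (by filter_upwards [hUu] with x hx; rw [hx] :
      (fun x => ENNReal.ofReal (u x) ^ P) =ᵐ[volume] fun x => U x ^ P)] at huP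
  have hFr : ∫⁻ x, F x ^ r ≠ ⊤ := by
    rwa [lintegral_congr_ae (by filter_upwards [hFf] with x hx; rw [hx] :
      (fun x => ENNReal.ofReal (f x) ^ r) =ᵐ[volume] fun x => F x ^ r)] at hfr
  have hF1 : ∫⁻ x, F x ≠ ⊤ := by rwa [lintegral_congr_ae hFf] at hf1
  have hset : ∀ t : ℝ, 0 ≤ t →
      volume {x | t < u x} = volume {x | (t.toNNReal : ℝ≥0∞) < U x} := fun t ht =>
    measure_congr (by
      filter_upwards [hUu] with x hx
      refine propext ?_
      change t < u x ↔ ENNReal.ofReal t < U x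
      rw [← hx, ENNReal.ofReal_lt_ofReal_iff_of_nonneg ht])
  obtain ⟨D, hD, hDb⟩ := exists_weak_bound_of_energy hU hF hθ1 hθP hUP hF1 ENNReal.coe_ne_top
    ENNReal.ofReal_ne_top fun k => (hE k).1
  obtain ⟨K, hK⟩ := exists_ae_bound_of_energy hU hF hθ1 hθP hr0 hrθ hUP hFr ENNReal.coe_ne_top
    ENNReal.ofReal_ne_top fun k => (hE k).2
  refine ⟨D, hD, fun t ht => ?_, K, ?_⟩
  · rw [hs, hset t ht.le]
    exact hDb t.toNNReal (Real.toNNReal_pos.2 ht)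
  · rw [hset K K.2, Real.toNNReal_coe]
    exact hK

end

end PLaplace

theorem lemma3p4 (N : ℕ) (p Λ : ℝ) (hp : 1 < p) (hpN : p < N)
    (q : ℝ≥0∞) (hq : ENNReal.ofReal (N / p) < q)
    (f : EuclideanSpace ℝ (Fin N) → ℝ) (hf_nonneg : ∀ᵐ x, 0 ≤ f x)
    (hf_one : MemLp f 1) (hf_q : MemLp f q)
    (u : EuclideanSpace ℝ (Fin N) → ℝ) (hu : PLaplace.IsSolution p Λ f u) :
    PLaplace.MemWeakLp (PLaplace.lowerStar N p - 1) u ∧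
      ∀ r : ℝ≥0∞, ENNReal.ofReal (PLaplace.lowerStar N p - 1) < r → MemLp u r := by
  have hs : 0 < PLaplace.lowerStar N p - 1 := by
    have : 0 < (N : ℝ) - p := by linarith
    rw [sub_pos, PLaplace.lowerStar, one_lt_div this]
    nlinarith
  obtain ⟨D, hD, hweak, K, hK⟩ := hu.exists_bounds hp hpN hq hf_one hf_q
  set s := PLaplace.lowerStar N p - 1
  have hum : AEStronglyMeasurable u volume := hu.2.choose_spec.1.1.1
  have hpos : ∀ᵐ x, 0 ≤ u x := hu.1.mono fun x hx => hx.le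
  refine ⟨⟨hum, ?_⟩, fun r hr => ?_⟩
  · refine lt_of_le_of_lt (b := D ^ (1 / s)) (iSup₂_le fun h hh => ?_)
      (ENNReal.rpow_lt_top_of_nonneg (by positivity) hD)
    have habs : volume {x | h < |u x|} = volume {x | h < u x} := measure_congr (by
      filter_upwards [hpos] with x hx
      refine propext ?_
      change h < |u x| ↔ h < u x
      rw [abs_of_nonneg hx])
    have h1 := ENNReal.rpow_le_rpow (hweak h hh) (by positivity : 0 ≤ 1 / s)
    rwa [ENNReal.mul_rpow_of_nonneg _ _ (by positivity), ← ENNReal.rpow_mul,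
      mul_one_div_cancel hs.ne', ENNReal.rpow_one, ← habs] at h1
  · rcases eq_or_ne r ⊤ with rfl | hrt
    · refine memLp_top_of_bound hum K ?_
      have h1 : ∀ᵐ x, ¬ K < u x := by
        rw [ae_iff]
        simpa using hK
      filter_upwards [hpos, h1] with x hx hx'
      rw [Real.norm_of_nonneg hx]
      exact not_lt.1 hx'
    · have hr0 : r ≠ 0 := (zero_le.trans_lt hr).ne'
      have hsr : s < r.toReal := by
        rwa [ENNReal.ofReal_lt_iff_lt_toReal hs.le hrt] at hr
      refine ⟨hum, (eLpNorm_lt_top_iff_lintegral_rpow_enorm_lt_top hr0 hrt).2 ?_⟩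
      refine lt_of_eq_of_lt (lintegral_congr_ae ?_)
        (PLaplace.lintegral_rpow_lt_top_of_weak_bound hpos hum.aemeasurable hs hsr hD hweak hK)
      filter_upwards [hpos] with x hx
      rw [← ofReal_norm, Real.norm_of_nonneg hx,
        ENNReal.ofReal_rpow_of_nonneg hx ENNReal.toReal_nonneg]
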